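/- Let $d \ge 1$ be an integer. There is a finite constant $C > 0$ depending only on $d$ such that the following holds for every $L > 0$ and every integer $N \ge 1$, where $N \ge 2$ if $d = 2$. Let $X_1, \dots, X_N, Y_1, \dots, Y_N$ be i.i.d. random variables taking values in the box $[0,L]^d$ with uniform distribution, i.e. $\mathbb{P}(X_i \in A) = |A|/L^d$ for every Borel set $A \subseteq [0,L]^d$, where $|A|$ is the Lebesgue measure of $A$. Put $r := L N^{-1/d}$, $$R_N := \sqrt{\mathbb{E}\bigg[\frac1N \min_{\sigma \in \mathcal{S}_N} \sum_{n=1}^N |Y_{\sigma(n)} - X_n|^2\bigg]}, \qquad \beta_d(N) := \begin{cases} \sqrt N & \text{if } d = 1,\\ \sqrt{\ln N} & \text{if } d = 2,\\ 1 & \text{if } d > 2,\end{cases}$$ where $\mathcal{S}_N$ is the set of permutations of $\{1,\dots,N\}$ and $|\cdot|$ is the Euclidean norm. Then the expectation is finite and $$R_N \le C\, r\, \beta_d(N) \qquad \text{and} \qquad r\, \beta_d(N) \le C\, R_N .$$ -/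

import Mathlib

open MeasureTheory ProbabilityTheory

/-- The box `[0,L]^d` in Euclidean space `ℝ^d`. -/
def box (d : ℕ) (L : ℝ) : Set (EuclideanSpace ℝ (Fin d)) :=
  {x | ∀ i, x i ∈ Set.Icc 0 L}

/-- The optimal bipartite matching cost `(1/N) min_σ ∑ₙ |y_{σ(n)} - xₙ|²` of two clouds of
`N` points, with the Euclidean norm and the minimum over all permutations `σ`. -/
noncomputable def matchingCost {d N : ℕ} (x y : Fin N → EuclideanSpace ℝ (Fin d)) : ℝ :=
  (1 / (N : ℝ)) *
    (Finset.univ : Finset (Equiv.Perm (Fin N))).inf' Finset.univ_nonempty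
      (fun σ => ∑ n, ‖y (σ n) - x n‖ ^ 2)

/-- The microscopic length scale `r = L N^{-1/d}`. -/
noncomputable def microScale (d : ℕ) (L : ℝ) (N : ℕ) : ℝ :=
  L * (N : ℝ) ^ (-(1 / (d : ℝ)))

/-- The dimension-dependent factor: `√N` if `d = 1`, `√(ln N)` if `d = 2`, `1` if `d > 2`. -/
noncomputable def matchingRate (d N : ℕ) : ℝ :=
  if d = 1 then √(N : ℝ) else if d = 2 then √(Real.log N) else 1

/-!
After rescaling to the unit box, write `ρ = N^{-1/d}` and let `W` be the optimal cost. The bounds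
`E W ≤ C ρ² β²` and `ρ² β² ≤ C E W` are proved by unrelated means.

**Upper bound.** By Birkhoff's theorem it is enough to couple the two empirical measures, and two
couplings with the Lebesgue measure can be composed (`matchingCost_le_treeCost`). A cloud is coupled
with the Lebesgue measure by recursive bisection: whenever a dyadic box `Q` is halved, the box `R`
which is being transported to it is cut in proportion to the numbers of points in the two halves,
so that `R` always has the volume that `Q` has for the empirical measure. The cost of the affine map
`R → Q` is explicit (`boxCost`). By `boxCost_child` one cut with proportion `p` changes the cost by
a term linear in `2p - 1`, which averages to zero because the binary digits of a uniform point are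
fair and independent, and by `ℓ_R ℓ_Q (2p - 1)² / 12`, where `E (2p - 1)² = 1/n` for a box with `n`
points. Hence each cut adds at most `ℓ_R ℓ_Q / 12` to the unnormalized mean, and the sum of
`ℓ_R ℓ_Q` over the boxes of one generation does not depend on the randomness
(`expect_treeCost_le`). With about `log₂ N` generations one obtains
`N⁻¹ ∑_q 2^{(d-2) q}` over `q ≤ d⁻¹ log₂ N`, plus the squared diameter `ρ²` of the last boxes; this
geometric sum is the origin of the three regimes.

**Lower bound.** In dimension one the squared displacement of the mean is of order `1/N`. For
`d ≥ 3` the distance of a point to its nearest neighbour in the other cloud is of order `ρ`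
(this holds for all `d`). In dimension two, test the matching against
`f = ∑ ± |ξ|⁻² cos (2π ξ·x)`, summed over integer frequencies `1 ≤ ξ₁, ξ₂ ≤ M` with `M ≈ N^{1/8}`,
the signs being those of `Z_ξ = ∑ cos (2π ξ·Y_n) - ∑ cos (2π ξ·X_n)`. Then
`∑ f(Y_n) - f(X_n) = ∑ |Z_ξ| / |ξ|²`, whose mean is at least `c √N Λ` with `Λ = ∑ |ξ|⁻²` of order
`log N`, since `E |Z_ξ|` is of order `√N` by a comparison of second and fourth moments. A second
order Taylor expansion at the points `X_n` (`sum_abs_wave_le`) bounds the same quantity by the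
Dirichlet energy of `f` over the cloud and the matching cost. The second derivatives of `f` are
at most `C M² ≤ C √N`, and the energy is of order `N Λ`: the waves are orthogonal for the
Lebesgue measure, and the empirical correlations are of order `√N` each, which is negligible as
there are only `M⁴` of them. Choosing the parameter of Young's inequality of order `N^{-1/2}` gives
`N E W ≥ c Λ`.
-/

/-! ### The matching cost -/

lemma matchingCost_le {d N : ℕ} (x y : Fin N → EuclideanSpace ℝ (Fin d))
    (σ : Equiv.Perm (Fin N)) :
    matchingCost x y ≤ (1 / (N : ℝ)) * ∑ n, ‖y (σ n) - x n‖ ^ 2 :=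
  mul_le_mul_of_nonneg_left (Finset.inf'_le _ (Finset.mem_univ σ)) (by positivity)

lemma exists_matchingCost_eq {d N : ℕ} (x y : Fin N → EuclideanSpace ℝ (Fin d)) :
    ∃ σ : Equiv.Perm (Fin N),
      matchingCost x y = (1 / (N : ℝ)) * ∑ n, ‖y (σ n) - x n‖ ^ 2 := by
  obtain ⟨σ, -, h⟩ := Finset.exists_mem_eq_inf' (Finset.univ_nonempty)
    (fun σ : Equiv.Perm (Fin N) => ∑ n, ‖y (σ n) - x n‖ ^ 2)
  exact ⟨σ, by rw [matchingCost, h]⟩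

lemma matchingCost_nonneg {d N : ℕ} (x y : Fin N → EuclideanSpace ℝ (Fin d)) :
    0 ≤ matchingCost x y := by
  obtain ⟨σ, h⟩ := exists_matchingCost_eq x y
  rw [h]
  positivity

lemma matchingCost_smul {d N : ℕ} {c : ℝ} (x y : Fin N → EuclideanSpace ℝ (Fin d)) :
    matchingCost (fun n => c • x n) (fun n => c • y n) = c ^ 2 * matchingCost x y := by
  have key : ∀ σ : Equiv.Perm (Fin N), ∑ n, ‖c • y (σ n) - c • x n‖ ^ 2 =
      c ^ 2 * ∑ n, ‖y (σ n) - x n‖ ^ 2 := fun σ => by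
    rw [Finset.mul_sum]
    refine Finset.sum_congr rfl fun n _ => ?_
    rw [← smul_sub, norm_smul, mul_pow, Real.norm_eq_abs, sq_abs]
  obtain ⟨σ, hσ⟩ := exists_matchingCost_eq (fun n => c • x n) (fun n => c • y n)
  obtain ⟨τ, hτ⟩ := exists_matchingCost_eq x y
  have h1 := matchingCost_le (fun n => c • x n) (fun n => c • y n) τ
  have h2 := matchingCost_le x y σ
  simp only [key] at hσ h1
  have h3 := mul_le_mul_of_nonneg_left h2 (sq_nonneg c)
  apply le_antisymm
  · rw [hτ]; linarith
  · rw [hσ]; linarith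

lemma measurable_matchingCost {d N : ℕ} {Ω : Type*} [MeasurableSpace Ω]
    {X Y : Fin N → Ω → EuclideanSpace ℝ (Fin d)}
    (hX : ∀ n, Measurable (X n)) (hY : ∀ n, Measurable (Y n)) :
    Measurable fun ω => matchingCost (fun n => X n ω) (fun n => Y n ω) := by
  have : Measurable fun ω => (Finset.univ : Finset (Equiv.Perm (Fin N))).sup'
      Finset.univ_nonempty (fun σ => -∑ n, ‖Y (σ n) ω - X n ω‖ ^ 2) := by
    have := Finset.measurable_sup' (s := (Finset.univ : Finset (Equiv.Perm (Fin N))))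
      Finset.univ_nonempty (f := fun σ ω => -∑ n, ‖Y (σ n) ω - X n ω‖ ^ 2)
      (fun σ _ => by
        refine (Finset.measurable_sum _ fun n _ => ?_).neg
        exact (((hY _).sub (hX _)).norm).pow_const 2)
    convert this using 1
    ext ω
    rw [Finset.sup'_apply]
  have h2 := this.neg.const_mul (1 / (N : ℝ))
  convert h2 using 1
  ext ω
  simp only [matchingCost, Pi.neg_apply]
  congr 1
  apply le_antisymm
  · obtain ⟨σ, -, h⟩ := Finset.exists_mem_eq_sup' (Finset.univ_nonempty)
      (fun σ : Equiv.Perm (Fin N) => -∑ n, ‖Y (σ n) ω - X n ω‖ ^ 2)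
    rw [h, neg_neg]
    exact Finset.inf'_le _ (Finset.mem_univ σ)
  · refine Finset.le_inf' _ _ fun σ _ => ?_
    have := Finset.le_sup' (fun σ : Equiv.Perm (Fin N) => -∑ n, ‖Y (σ n) ω - X n ω‖ ^ 2)
      (Finset.mem_univ σ)
    linarith

/-- Kantorovich relaxation: by Birkhoff's theorem a doubly stochastic weighting of the pairs costs
at least as much as the best permutation. -/
lemma matchingCost_le_of_doublyStochastic {d N : ℕ} (x y : Fin N → EuclideanSpace ℝ (Fin d))
    {M : Matrix (Fin N) (Fin N) ℝ} (hM : M ∈ doublyStochastic ℝ (Fin N)) :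
    matchingCost x y ≤ (1 / (N : ℝ)) * ∑ i, ∑ j, M i j * ‖y j - x i‖ ^ 2 := by
  obtain ⟨w, hw0, hw1, hw⟩ := exists_eq_sum_perm_of_mem_doublyStochastic hM
  have h : ∑ i, ∑ j, M i j * ‖y j - x i‖ ^ 2 = ∑ σ, w σ * ∑ i, ‖y (σ i) - x i‖ ^ 2 := by
    have hM : ∀ i j, M i j = ∑ σ, w σ * if σ i = j then 1 else 0 := fun i j => by
      rw [← hw, Matrix.sum_apply]
      simp [Equiv.Perm.permMatrix, PEquiv.toMatrix_apply, eq_comm]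
    simp only [hM, Finset.sum_mul, Finset.mul_sum]
    rw [Finset.sum_congr rfl fun i _ => Finset.sum_comm, Finset.sum_comm]
    simp
  rw [h, Finset.mul_sum]
  calc matchingCost x y = ∑ σ, w σ * matchingCost x y := by rw [← Finset.sum_mul, hw1, one_mul]
    _ ≤ _ := by
        refine Finset.sum_le_sum fun σ _ => ?_
        have := mul_le_mul_of_nonneg_left (matchingCost_le x y σ) (hw0 σ)
        linarith

/-! ### Half-open boxes -/

/-- The half-open box with lower corner `a` and side lengths `l`. -/
def cell {d : ℕ} (a l : Fin d → ℝ) : Set (EuclideanSpace ℝ (Fin d)) :=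
  {x | ∀ i, x i ∈ Set.Ico (a i) (a i + l i)}

lemma cell_eq_preimage {d : ℕ} (a l : Fin d → ℝ) :
    cell a l = (WithLp.ofLp : EuclideanSpace ℝ (Fin d) → Fin d → ℝ) ⁻¹'
      (Set.univ.pi fun i => Set.Ico (a i) (a i + l i)) := by
  ext x; simp [cell]

lemma measurableSet_cell {d : ℕ} (a l : Fin d → ℝ) : MeasurableSet (cell a l) := by
  rw [cell_eq_preimage]
  exact (MeasurableSet.univ_pi fun i => measurableSet_Ico).preimage (WithLp.measurable_ofLp _ _)

lemma setIntegral_preimage_pi {d : ℕ} (s : Fin d → Set ℝ)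
    (g : Fin d → ℝ → ℝ) :
    ∫ x in (WithLp.ofLp : EuclideanSpace ℝ (Fin d) → Fin d → ℝ) ⁻¹' (Set.univ.pi s),
      ∏ i, g i (x i) = ∏ i, ∫ t in s i, g i t := by
  have h := (PiLp.volume_preserving_ofLp (Fin d)).setIntegral_preimage_emb
    (MeasurableEquiv.toLp 2 (Fin d → ℝ)).symm.measurableEmbedding
    (fun x => ∏ i, g i (x i)) (Set.univ.pi s)
  rw [h, volume_pi, Measure.restrict_pi_pi]
  exact integral_fintype_prod_eq_prod (μ := fun i => volume.restrict (s i)) g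

lemma volume_cell {d : ℕ} {a l : Fin d → ℝ} (hl : ∀ i, 0 ≤ l i) :
    volume (cell a l) = ENNReal.ofReal (∏ i, l i) := by
  rw [cell_eq_preimage, (PiLp.volume_preserving_ofLp (Fin d)).measure_preimage
    (MeasurableSet.univ_pi fun i => measurableSet_Ico).nullMeasurableSet, volume_pi, Measure.pi_pi,
    ENNReal.ofReal_prod_of_nonneg fun i _ => hl i]
  simp

lemma setIntegral_cell_coord {d : ℕ} {a l : Fin d → ℝ} (hl : ∀ i, 0 ≤ l i) (g : ℝ → ℝ)
    (i : Fin d) :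
    (∫ x in cell a l, g (x i)) = (∏ k ∈ Finset.univ.erase i, l k) *
      ∫ t in Set.Ico (a i) (a i + l i), g t := by
  have h := setIntegral_preimage_pi (fun i => Set.Ico (a i) (a i + l i))
    (fun k => if k = i then g else fun _ => 1)
  rw [← cell_eq_preimage] at h
  rw [← Finset.prod_erase_mul _ _ (Finset.mem_univ i)] at h
  rw [if_pos rfl] at h
  rw [Finset.prod_congr rfl (g := fun k => l k) (s₂ := Finset.univ.erase i)] at h
  · rw [← h]
    refine integral_congr_ae (Filter.Eventually.of_forall fun x => ?_)
    dsimp only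
    rw [← Finset.prod_erase_mul _ _ (Finset.mem_univ i), if_pos rfl, Finset.prod_eq_one, one_mul]
    intro k hk
    rw [if_neg (Finset.ne_of_mem_erase hk)]
  · intro k hk
    rw [if_neg (Finset.ne_of_mem_erase hk)]
    simp [hl k]

lemma setIntegral_cell_sq {d : ℕ} {a l : Fin d → ℝ} (hl : ∀ i, 0 ≤ l i) (c : ℝ) (i : Fin d) :
    (∫ x in cell a l, (x i - c) ^ 2) =
      (∏ k, l k) * ((a i + l i / 2 - c) ^ 2 + l i ^ 2 / 12) := by
  rw [setIntegral_cell_coord hl (fun t => (t - c) ^ 2) i, integral_Ico_eq_integral_Ioc,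
    ← intervalIntegral.integral_of_le (by linarith [hl i]),
    intervalIntegral.integral_comp_sub_right (fun t => t ^ 2) c, integral_pow,
    ← Finset.prod_erase_mul _ _ (Finset.mem_univ i)]
  push_cast
  ring

lemma measurableSet_box (d : ℕ) (L : ℝ) : MeasurableSet (box d L) := by
  have : box d L = ⋂ i, (fun x : EuclideanSpace ℝ (Fin d) => x i) ⁻¹' Set.Icc 0 L := by
    ext x; simp [box]
  rw [this]
  exact MeasurableSet.iInter fun i => measurableSet_Icc.preimage (by fun_prop)

lemma box_eq_preimage (d : ℕ) (L : ℝ) :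
    box d L = (WithLp.ofLp : EuclideanSpace ℝ (Fin d) → Fin d → ℝ) ⁻¹'
      (Set.univ.pi fun _ => Set.Icc 0 L) := by
  ext x; simp [box, Pi.le_def, forall_and]

lemma volume_box {d : ℕ} {L : ℝ} (hL : 0 ≤ L) : volume (box d L) = ENNReal.ofReal (L ^ d) := by
  rw [box_eq_preimage, (PiLp.volume_preserving_ofLp (Fin d)).measure_preimage
    (MeasurableSet.univ_pi fun i => measurableSet_Icc).nullMeasurableSet, volume_pi, Measure.pi_pi,
    ENNReal.ofReal_pow hL]
  simp

instance isProbabilityMeasure_restrict_box (d : ℕ) :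
    IsProbabilityMeasure ((volume : Measure (EuclideanSpace ℝ (Fin d))).restrict (box d 1)) :=
  ⟨by rw [Measure.restrict_apply_univ, volume_box zero_le_one]; simp⟩

lemma norm_sq_sub_le_of_mem_box {d : ℕ} {x y : EuclideanSpace ℝ (Fin d)} (hx : x ∈ box d 1)
    (hy : y ∈ box d 1) : ‖y - x‖ ^ 2 ≤ d := by
  rw [EuclideanSpace.norm_sq_eq]
  calc ∑ i, ‖(y - x) i‖ ^ 2 ≤ ∑ _i : Fin d, (1 : ℝ) := by
        refine Finset.sum_le_sum fun i _ => ?_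
        rw [PiLp.sub_apply, Real.norm_eq_abs, sq_abs]
        have h1 := hx i
        have h2 := hy i
        rw [Set.mem_Icc] at h1 h2
        nlinarith
    _ = d := by simp

/-- Rescaling a uniform point of `[0,L]^d` to the unit box. -/
lemma map_inv_smul_of_isUniform {d : ℕ} {L : ℝ} (hL : 0 < L) {Ω : Type*} [MeasurableSpace Ω]
    {P : Measure Ω} {X : Ω → EuclideanSpace ℝ (Fin d)} (hX : Measurable X)
    (h : pdf.IsUniform X (box d L) P volume) :
    P.map (fun ω => L⁻¹ • X ω) = volume.restrict (box d 1) := by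
  have h1 : P.map (fun ω => L⁻¹ • X ω) = (P.map X).map (fun x => L⁻¹ • x) := by
    rw [Measure.map_map (by fun_prop) hX]; rfl
  have hL' : L⁻¹ ≠ 0 := by positivity
  have hpre : (fun x : EuclideanSpace ℝ (Fin d) => L⁻¹ • x) ⁻¹' box d 1 = box d L := by
    ext x
    simp only [box, Set.mem_preimage, Set.mem_ofPred_eq, PiLp.smul_apply, smul_eq_mul, Set.mem_Icc]
    refine forall_congr' fun i => ?_
    rw [inv_mul_le_iff₀ hL, mul_one]
    exact and_congr_left fun _ => ⟨fun h => by
      have := mul_nonneg hL.le h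
      rwa [mul_inv_cancel_left₀ hL.ne'] at this, fun h => by positivity⟩
  rw [h1, h, ProbabilityTheory.cond, ← hpre, Measure.map_smul,
    ← Measure.restrict_map (by fun_prop) (measurableSet_box d 1), hpre,
    Measure.map_addHaar_smul _ hL', Measure.restrict_smul, smul_smul, volume_box hL.le]
  have : (ENNReal.ofReal (L ^ d))⁻¹ *
      ENNReal.ofReal |(L⁻¹ ^ Module.finrank ℝ (EuclideanSpace ℝ (Fin d)))⁻¹| = 1 := by
    rw [finrank_euclideanSpace_fin, inv_pow, inv_inv, abs_of_pos (by positivity)]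
    exact ENNReal.inv_mul_cancel (by simpa using by positivity) ENNReal.ofReal_ne_top
  rw [this, one_smul]

lemma ae_mem_box {d : ℕ} {Ω : Type*} [MeasurableSpace Ω] {P : Measure Ω}
    {X : Ω → EuclideanSpace ℝ (Fin d)} (hX : Measurable X)
    (h : P.map X = volume.restrict (box d 1)) : ∀ᵐ ω ∂P, X ω ∈ box d 1 :=
  ae_of_ae_map hX.aemeasurable (h ▸ ae_restrict_mem (measurableSet_box d 1))

lemma integral_comp_uniform {d : ℕ} {Ω : Type*} [MeasurableSpace Ω] {P : Measure Ω}
    {X : Ω → EuclideanSpace ℝ (Fin d)} (hX : Measurable X)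
    (h : P.map X = volume.restrict (box d 1)) {g : EuclideanSpace ℝ (Fin d) → ℝ}
    (hg : Measurable g) : ∫ ω, g (X ω) ∂P = ∫ x in box d 1, g x := by
  rw [← h, integral_map hX.aemeasurable hg.aestronglyMeasurable]

lemma ae_norm_matchingCost_le {d N : ℕ} {Ω : Type*} [MeasurableSpace Ω] {P : Measure Ω}
    {X Y : Fin N → Ω → EuclideanSpace ℝ (Fin d)}
    (hX : ∀ n, Measurable (X n)) (hY : ∀ n, Measurable (Y n))
    (hXl : ∀ n, P.map (X n) = volume.restrict (box d 1))
    (hYl : ∀ n, P.map (Y n) = volume.restrict (box d 1)) :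
    ∀ᵐ ω ∂P, ‖matchingCost (fun n => X n ω) (fun n => Y n ω)‖ ≤ d := by
  filter_upwards [ae_all_iff.2 fun n => ae_mem_box (hX n) (hXl n),
    ae_all_iff.2 fun n => ae_mem_box (hY n) (hYl n)] with ω h1 h2
  rw [Real.norm_of_nonneg (matchingCost_nonneg _ _)]
  refine (matchingCost_le _ _ 1).trans ?_
  calc 1 / (N : ℝ) * ∑ n, ‖Y ((1 : Equiv.Perm (Fin N)) n) ω - X n ω‖ ^ 2
      ≤ 1 / (N : ℝ) * ∑ _n : Fin N, (d : ℝ) := by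
        gcongr with n
        exact norm_sq_sub_le_of_mem_box (h1 n) (h2 _)
    _ ≤ d := by
        rw [Finset.sum_const, Finset.card_univ, Fintype.card_fin, nsmul_eq_mul, ← mul_assoc]
        exact mul_le_of_le_one_left (Nat.cast_nonneg d) (by
          rw [one_div]; exact inv_mul_le_one)

lemma integrable_matchingCost {d N : ℕ} {Ω : Type*} [MeasurableSpace Ω] {P : Measure Ω}
    [IsFiniteMeasure P] {X Y : Fin N → Ω → EuclideanSpace ℝ (Fin d)}
    (hX : ∀ n, Measurable (X n)) (hY : ∀ n, Measurable (Y n))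
    (hXl : ∀ n, P.map (X n) = volume.restrict (box d 1))
    (hYl : ∀ n, P.map (Y n) = volume.restrict (box d 1)) :
    Integrable (fun ω => matchingCost (fun n => X n ω) (fun n => Y n ω)) P :=
  Integrable.of_bound (measurable_matchingCost hX hY).aestronglyMeasurable d
    (ae_norm_matchingCost_le hX hY hXl hYl)

/-! ### Sums of fair signs -/

/-- The sign `+1` for `false`, `-1` for `true`. -/
def boolSign (b : Bool) : ℝ := if b then -1 else 1

lemma expect_eq_zero_of_flip {ι : Type*} [Fintype ι] [DecidableEq ι] (i : ι)
    (g : (ι → Bool) → ℝ) (hg : ∀ ε, g (Function.update ε i (!ε i)) = -g ε) :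
    Finset.univ.expect g = 0 := by
  have hinv : Function.Involutive fun ε : ι → Bool => Function.update ε i (!ε i) := fun ε => by
    simp
  have h : Finset.univ.expect g = Finset.univ.expect fun ε => -g ε :=
    Fintype.expect_equiv hinv.toPerm _ _ fun ε => by
      simp only [Function.Involutive.coe_toPerm, hg, neg_neg]
  rw [Finset.expect_neg_distrib] at h
  linarith

lemma expect_sum_boolSign {ι : Type*} [Fintype ι] [DecidableEq ι] (S : Finset ι) :
    (Finset.univ.expect fun ε : ι → Bool => ∑ i ∈ S, boolSign (ε i)) = 0 := by
  rw [Finset.expect_sum_comm]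
  refine Finset.sum_eq_zero fun i _ => expect_eq_zero_of_flip i _ fun ε => ?_
  cases h : ε i <;> simp [boolSign]

lemma expect_sq_sum_boolSign {ι : Type*} [Fintype ι] [DecidableEq ι] (S : Finset ι) :
    (Finset.univ.expect fun ε : ι → Bool => (∑ i ∈ S, boolSign (ε i)) ^ 2) = (S.card : ℝ) := by
  simp only [sq, Finset.sum_mul_sum]
  rw [Finset.expect_sum_comm]
  simp only [Finset.expect_sum_comm]
  have h : ∀ i ∈ S, ∑ k ∈ S, (Finset.univ.expect fun ε : ι → Bool =>
      boolSign (ε i) * boolSign (ε k)) = 1 := fun i hi => by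
    rw [Finset.sum_eq_single_of_mem i hi]
    · have : ∀ ε : ι → Bool, boolSign (ε i) * boolSign (ε i) = 1 := fun ε => by
        cases ε i <;> simp [boolSign]
      simp only [this]
      exact Fintype.expect_const 1
    · intro k _ hk
      refine expect_eq_zero_of_flip i _ fun ε => ?_
      rw [Function.update_self, Function.update_of_ne hk]
      cases h : ε i <;> cases h' : ε k <;> simp [boolSign]
  rw [Finset.sum_congr rfl h]
  simp

lemma sum_boolSign {ι : Type*} (S : Finset ι) (ε : ι → Bool) :
    ∑ i ∈ S, boolSign (ε i) = 2 * ((S.filter fun i => ε i = false).card : ℝ) - S.card := by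
  have h : ∀ i, boolSign (ε i) = 2 * (if ε i = false then (1 : ℝ) else 0) - 1 := fun i => by
    cases ε i <;> norm_num [boolSign]
  simp only [h, Finset.sum_sub_distrib, ← Finset.mul_sum, Finset.sum_boole]
  simp

/-! ### Splitting boxes -/

/-- Lower corner of a child when the box `(a, l)` is cut across direction `j` at the fraction `p`;
`b = true` is the upper child. -/
def childCorner {d : ℕ} (b : Bool) (p : ℝ) (j : Fin d) (a l : Fin d → ℝ) : Fin d → ℝ :=
  if b then Function.update a j (a j + p * l j) else a

/-- Side lengths of a child when a box with sides `l` is cut across direction `j` at the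
fraction `p`; `b = true` is the upper child. -/
def childSide {d : ℕ} (b : Bool) (p : ℝ) (j : Fin d) (l : Fin d → ℝ) : Fin d → ℝ :=
  Function.update l j ((if b then 1 - p else p) * l j)

lemma childSide_nonneg {d : ℕ} {b : Bool} {p : ℝ} {j : Fin d} {l : Fin d → ℝ} (hp0 : 0 ≤ p)
    (hp1 : p ≤ 1) (hl : ∀ i, 0 ≤ l i) (i : Fin d) : 0 ≤ childSide b p j l i := by
  unfold childSide
  rcases eq_or_ne i j with rfl | h
  · rw [Function.update_self]
    refine mul_nonneg ?_ (hl i)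
    split_ifs <;> linarith
  · rw [Function.update_of_ne h]
    exact hl i

lemma prod_childSide {d : ℕ} (b : Bool) (p : ℝ) (j : Fin d) (l : Fin d → ℝ) :
    ∏ i, childSide b p j l i = (if b then 1 - p else p) * ∏ i, l i := by
  rw [← Finset.mul_prod_erase _ _ (Finset.mem_univ j),
    ← Finset.mul_prod_erase _ l (Finset.mem_univ j), childSide, Function.update_self, mul_assoc]
  congr 2
  exact Finset.prod_congr rfl fun i hi => by
    rw [Function.update_of_ne (Finset.ne_of_mem_erase hi)]

lemma mem_cell_child {d : ℕ} {b : Bool} {p : ℝ} {j : Fin d} {a l : Fin d → ℝ} (hp0 : 0 ≤ p)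
    (hp1 : p ≤ 1) (hl : ∀ i, 0 ≤ l i) {x : EuclideanSpace ℝ (Fin d)} :
    x ∈ cell (childCorner b p j a l) (childSide b p j l) ↔
      x ∈ cell a l ∧ decide (a j + p * l j ≤ x j) = b := by
  have h1 : 0 ≤ p * l j := mul_nonneg hp0 (hl j)
  have h2 : p * l j ≤ l j := mul_le_of_le_one_left (hl j) hp1
  have key : (∀ i, i ≠ j → x i ∈ Set.Ico (childCorner b p j a l i)
      (childCorner b p j a l i + childSide b p j l i)) ↔
      ∀ i, i ≠ j → x i ∈ Set.Ico (a i) (a i + l i) := by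
    refine forall_congr' fun i => forall_congr' fun hi => ?_
    cases b <;> simp [childCorner, childSide, Function.update_of_ne hi]
  have split : ∀ q : Fin d → Prop, (∀ i, q i) ↔ q j ∧ ∀ i, i ≠ j → q i := fun q =>
    ⟨fun h => ⟨h j, fun i _ => h i⟩, fun h i => by
      rcases eq_or_ne i j with rfl | hi
      exacts [h.1, h.2 i hi]⟩
  simp only [cell, Set.mem_ofPred_eq]
  rw [split, key, split fun i => x i ∈ Set.Ico (a i) (a i + l i), and_right_comm]
  refine and_congr_left fun _ => ?_
  cases b
  · simp only [childCorner, childSide, Function.update_self, Set.mem_Ico, decide_eq_false_iff_not,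
      not_le, Bool.false_eq_true, if_false]
    constructor
    · rintro ⟨h3, h4⟩; exact ⟨⟨h3, by linarith⟩, h4⟩
    · rintro ⟨⟨h3, h4⟩, h5⟩; exact ⟨h3, h5⟩
  · simp only [childCorner, childSide, Function.update_self, Set.mem_Ico, decide_eq_true_eq,
      if_true]
    constructor
    · rintro ⟨h3, h4⟩; exact ⟨⟨by linarith, by linarith⟩, h3⟩
    · rintro ⟨⟨h3, h4⟩, h5⟩; exact ⟨h5, by linarith⟩

/-- The mean of `|T x - x|²` over the box `(a, l)`, where `T` is the affine map, increasing in each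
coordinate, onto the box `(q, m)`. -/
noncomputable def boxCost {d : ℕ} (a l q m : Fin d → ℝ) : ℝ :=
  ∑ i, ((a i + l i / 2 - (q i + m i / 2)) ^ 2 + (l i - m i) ^ 2 / 12)

lemma boxCost_self {d : ℕ} (a l : Fin d → ℝ) : boxCost a l a l = 0 := by
  simp [boxCost]

/-- Cutting `(q, m)` in half and `(a, l)` at the fraction `p` changes the mean cost by a term that
is linear in `2p - 1` and a term that is quadratic in it, with no other correction. -/
lemma boxCost_child {d : ℕ} (p : ℝ) (j : Fin d) (a l q m : Fin d → ℝ) :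
    p * boxCost (childCorner false p j a l) (childSide false p j l)
        (childCorner false (1 / 2) j q m) (childSide false (1 / 2) j m) +
      (1 - p) * boxCost (childCorner true p j a l) (childSide true p j l)
        (childCorner true (1 / 2) j q m) (childSide true (1 / 2) j m) =
    boxCost a l q m + (a j + l j / 2 - (q j + m j / 2)) * (2 * p - 1) * m j / 2 +
      l j * m j * (2 * p - 1) ^ 2 / 12 := by
  unfold boxCost
  simp only [← Finset.add_sum_erase _ _ (Finset.mem_univ j)]
  have h : ∀ b, ∑ i ∈ Finset.univ.erase j,
      ((childCorner b p j a l i + childSide b p j l i / 2 -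
        (childCorner b (1 / 2) j q m i + childSide b (1 / 2) j m i / 2)) ^ 2 +
        (childSide b p j l i - childSide b (1 / 2) j m i) ^ 2 / 12) =
      ∑ i ∈ Finset.univ.erase j,
        ((a i + l i / 2 - (q i + m i / 2)) ^ 2 + (l i - m i) ^ 2 / 12) := fun b =>
    Finset.sum_congr rfl fun i hi => by
      have hi := Finset.ne_of_mem_erase hi
      cases b <;> simp [childCorner, childSide, Function.update_of_ne hi]
  rw [h, h]
  simp only [childCorner, childSide, Function.update_self, if_true, Bool.false_eq_true, if_false]
  ring

/-! ### Transport along a dyadic tree -/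

/-- The binary digits of a point of the box `(q, m)`: at step `k` the current box is halved across
direction `s k`, and the digit records which half contains the point. -/
noncomputable def dyadicCode {d : ℕ} : (K : ℕ) → (ℕ → Fin d) → (Fin d → ℝ) → (Fin d → ℝ) →
    EuclideanSpace ℝ (Fin d) → Fin K → Bool
  | 0, _, _, _, _ => Fin.elim0
  | K + 1, s, q, m, x =>
    let b : Bool := decide (q (s 0) + 1 / 2 * m (s 0) ≤ x (s 0))
    Fin.cons b (dyadicCode K (fun k => s (k + 1)) (childCorner b (1 / 2) (s 0) q m)
      (childSide b (1 / 2) (s 0) m) x)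

/-- Cost of transporting the box `(a, l)` to the points with indices in `S` and digits `b` in the
box `(q, m)`. Each halving of `(q, m)` is accompanied by a cut of `(a, l)` in proportion to the
numbers of points; after `K` cuts, each piece of `(a, l)` is spread over the points of
the corresponding dyadic box. -/
noncomputable def treeCost {d : ℕ} {ι : Type*} : (K : ℕ) → (ℕ → Fin d) → Finset ι →
    (Fin d → ℝ) → (Fin d → ℝ) → (Fin d → ℝ) → (Fin d → ℝ) → (ι → Fin K → Bool) → ℝ
  | 0, _, S, a, l, q, m, _ => S.card * (2 * boxCost a l q m + ∑ i, m i ^ 2)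
  | K + 1, s, S, a, l, q, m, b =>
    let S' : Bool → Finset ι := fun c => S.filter fun i => b i 0 = c
    let p : ℝ := (S' false).card / S.card
    let t : Bool → ℝ := fun c => treeCost K (fun k => s (k + 1)) (S' c)
      (childCorner c p (s 0) a l) (childSide c p (s 0) l)
      (childCorner c (1 / 2) (s 0) q m) (childSide c (1 / 2) (s 0) m) (fun i => Fin.tail (b i))
    t false + t true

lemma treeCost_congr {d : ℕ} {ι : Type*} (K : ℕ) (s : ℕ → Fin d) (S : Finset ι)
    (a l q m : Fin d → ℝ) {b b' : ι → Fin K → Bool} (h : ∀ i ∈ S, b i = b' i) :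
    treeCost K s S a l q m b = treeCost K s S a l q m b' := by
  induction K generalizing s S a l q m with
  | zero => rfl
  | succ K ih =>
    have hf : ∀ c, (S.filter fun i => b i 0 = c) = S.filter fun i => b' i 0 = c := fun c =>
      Finset.filter_congr fun i hi => by rw [h i hi]
    simp only [treeCost, hf]
    congr 1 <;>
    · apply ih
      intro i hi
      rw [h i (Finset.mem_filter.1 hi).1]

lemma integrableOn_cell_coord_sq {d : ℕ} {a l : Fin d → ℝ} (hl : ∀ i, 0 ≤ l i) (c : ℝ)
    (i : Fin d) : IntegrableOn (fun x : EuclideanSpace ℝ (Fin d) => (x i - c) ^ 2) (cell a l) := by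
  refine Measure.integrableOn_of_bounded (M := (|a i - c| + l i) ^ 2) ?_ ?_ ?_
  · rw [volume_cell hl]; exact ENNReal.ofReal_ne_top
  · exact (by fun_prop : Continuous fun x : EuclideanSpace ℝ (Fin d) =>
      (x i - c) ^ 2).aestronglyMeasurable
  · filter_upwards [ae_restrict_mem (measurableSet_cell a l)] with x hx
    have h := hx i
    rw [Set.mem_Ico] at h
    rw [norm_pow, Real.norm_eq_abs]
    gcongr
    calc |x i - c| = |(a i - c) + (x i - a i)| := by ring_nf
      _ ≤ |a i - c| + |x i - a i| := abs_add_le _ _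
      _ ≤ _ := by rw [abs_of_nonneg (by linarith : 0 ≤ x i - a i)]; linarith

/-- Cost of sending the box `(a, l)` to a single point of the box `(q, m)`, compared with the cost
of the affine map between the boxes. -/
lemma setIntegral_cell_norm_sq_le {d : ℕ} {a l q m : Fin d → ℝ} (hl : ∀ i, 0 ≤ l i)
    {y : EuclideanSpace ℝ (Fin d)} (hy : y ∈ cell q m) :
    (∫ x in cell a l, ‖x - y‖ ^ 2) ≤ (∏ i, l i) * (2 * boxCost a l q m + ∑ i, m i ^ 2) := by
  simp only [EuclideanSpace.norm_sq_eq, PiLp.sub_apply, Real.norm_eq_abs, sq_abs]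
  rw [integral_finsetSum _ fun i _ => integrableOn_cell_coord_sq hl (y i) i]
  simp only [setIntegral_cell_sq hl]
  rw [← Finset.mul_sum, boxCost, Finset.mul_sum _ _ (2 : ℝ), ← Finset.sum_add_distrib]
  refine mul_le_mul_of_nonneg_left (Finset.sum_le_sum fun i _ => ?_)
    (Finset.prod_nonneg fun i _ => hl i)
  have h := hy i
  rw [Set.mem_Ico] at h
  have h1 : (q i + m i / 2 - y i) ^ 2 ≤ (m i / 2) ^ 2 :=
    sq_le_sq' (by linarith) (by linarith)
  nlinarith [sq_nonneg ((a i + l i / 2 - (q i + m i / 2)) - (q i + m i / 2 - y i)),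
    sq_nonneg ((l i - m i) - m i), sq_nonneg (m i)]

/-- The transport described by `treeCost`, in the form of densities: `f i` is the part of the
Lebesgue measure on `(a, l)` which is sent to the point `x i`. -/
lemma exists_densities {d : ℕ} {ι : Type*} {c : ℝ} (hc : 0 < c)
    (x : ι → EuclideanSpace ℝ (Fin d)) (K : ℕ) :
    ∀ (s : ℕ → Fin d) (S : Finset ι) (a l q m : Fin d → ℝ), (∀ i, 0 ≤ l i) → (∀ i, 0 ≤ m i) →
      c * S.card = ∏ i, l i → (∀ i ∈ S, x i ∈ cell q m) →
      ∃ f : ι → EuclideanSpace ℝ (Fin d) → ℝ, (∀ i, Measurable (f i)) ∧ (∀ i z, 0 ≤ f i z) ∧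
        (∀ z, ∑ i ∈ S, f i z = (cell a l).indicator 1 z) ∧ (∀ i ∈ S, ∫ z, f i z = c) ∧
        ∑ i ∈ S, ∫ z, f i z * ‖z - x i‖ ^ 2 ≤
          c * treeCost K s S a l q m (fun i => dyadicCode K s q m (x i)) := by
  induction K with
  | zero =>
    intro s S a l q m hl hm hvol hx
    rcases S.eq_empty_or_nonempty with rfl | hS
    · refine ⟨fun _ _ => 0, fun _ => measurable_const, fun _ _ => le_rfl, fun z => ?_, by simp,
        by simp [treeCost]⟩
      rw [Finset.sum_empty, Set.indicator_of_notMem]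
      intro hz
      rw [Finset.card_empty, Nat.cast_zero, mul_zero] at hvol
      obtain ⟨i, -, hi⟩ := Finset.prod_eq_zero_iff.1 hvol.symm
      have := hz i
      rw [hi, add_zero, Set.Ico_self] at this
      exact this
    · have hn : (0 : ℝ) < S.card := by exact_mod_cast hS.card_pos
      have hint : ∀ (y : EuclideanSpace ℝ (Fin d)),
          (∫ z, (cell a l).indicator (fun _ => (S.card : ℝ)⁻¹) z * ‖z - y‖ ^ 2) =
          (S.card : ℝ)⁻¹ * ∫ z in cell a l, ‖z - y‖ ^ 2 := fun y => by
        rw [← integral_const_mul, ← integral_indicator (measurableSet_cell a l)]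
        congr 1
        ext z
        by_cases hz : z ∈ cell a l <;> simp [hz]
      refine ⟨fun _ => (cell a l).indicator fun _ => (S.card : ℝ)⁻¹,
        fun _ => measurable_const.indicator (measurableSet_cell a l),
        fun _ z => Set.indicator_nonneg (fun _ _ => by positivity) z, fun z => ?_, fun i hi => ?_,
        ?_⟩
      · by_cases hz : z ∈ cell a l <;> simp [hz, hn.ne']
      · rw [integral_indicator (measurableSet_cell a l), setIntegral_const, Measure.real,
          volume_cell hl, ENNReal.toReal_ofReal (Finset.prod_nonneg fun i _ => hl i), ← hvol,
          smul_eq_mul]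
        field_simp
      · calc _ = ∑ i ∈ S, (S.card : ℝ)⁻¹ * ∫ z in cell a l, ‖z - x i‖ ^ 2 :=
              Finset.sum_congr rfl fun i _ => hint (x i)
          _ ≤ ∑ i ∈ S, (S.card : ℝ)⁻¹ *
              ((∏ i, l i) * (2 * boxCost a l q m + ∑ i, m i ^ 2)) := by
            refine Finset.sum_le_sum fun i hi => mul_le_mul_of_nonneg_left ?_ (by positivity)
            exact setIntegral_cell_norm_sq_le hl (hx i hi)
          _ = _ := by
            rw [Finset.sum_const, nsmul_eq_mul, ← hvol, treeCost]
            field_simp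
  | succ K ih =>
    intro s S a l q m hl hm hvol hx
    set bit : ι → Bool := fun i => decide (q (s 0) + 1 / 2 * m (s 0) ≤ x i (s 0)) with hbit
    set S' : Bool → Finset ι := fun c => S.filter fun i => bit i = c with hS'
    set p : ℝ := (S' false).card / S.card with hp
    have hcard : ((S' false).card : ℝ) + (S' true).card = S.card := by
      rw [← Nat.cast_add, hS']
      have := Finset.card_filter_add_card_filter_not (s := S) (fun i => bit i = false)
      simp only [Bool.not_eq_false] at this
      exact_mod_cast this
    have hpn : p * S.card = (S' false).card := by
      rcases S.eq_empty_or_nonempty with h0 | h0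
      · simp [h0, hS']
      · have : (S.card : ℝ) ≠ 0 := by exact_mod_cast h0.card_ne_zero
        rw [hp]; field_simp
    have hp0 : 0 ≤ p := by positivity
    have hp1 : p ≤ 1 := div_le_one_of_le₀
      (by rw [← hcard]; linarith [Nat.cast_nonneg (α := ℝ) (S' true).card]) (by positivity)
    have hex : ∀ b : Bool, _ := fun b => ih (fun k => s (k + 1)) (S' b)
      (childCorner b p (s 0) a l) (childSide b p (s 0) l) (childCorner b (1 / 2) (s 0) q m)
      (childSide b (1 / 2) (s 0) m) (childSide_nonneg hp0 hp1 hl)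
      (childSide_nonneg (by norm_num) (by norm_num) hm)
      (by
        rw [prod_childSide, ← hvol]
        cases b
        · simp only [Bool.false_eq_true, if_false]; rw [← hpn]; ring
        · simp only [if_true]
          have : ((S' true).card : ℝ) = (1 - p) * S.card := by linarith
          rw [this]; ring)
      (fun i hi => by
        rw [hS', Finset.mem_filter] at hi
        exact (mem_cell_child (by norm_num) (by norm_num) hm).2 ⟨hx i hi.1, hi.2⟩)
    choose f hfm hf0 hfs hfi hfc using hex
    have hsum : ∀ g : Bool → ι → ℝ, ∑ i ∈ S, g (bit i) i =
        ∑ i ∈ S' false, g false i + ∑ i ∈ S' true, g true i := fun g => by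
      rw [← Finset.sum_filter_add_sum_filter_not S (fun i => bit i = false)]
      simp only [Bool.not_eq_false]
      congr 1
      · exact Finset.sum_congr rfl fun i hi => by rw [(Finset.mem_filter.1 hi).2]
      · exact Finset.sum_congr rfl fun i hi => by rw [(Finset.mem_filter.1 hi).2]
    refine ⟨fun i => f (bit i) i, fun i => hfm _ i, fun i z => hf0 _ i z, fun z => ?_,
      fun i hi => hfi _ i (Finset.mem_filter.2 ⟨hi, rfl⟩), ?_⟩
    · rw [hsum fun b i => f b i z, hfs, hfs]
      by_cases hz : z ∈ cell a l
      · cases hb : decide (a (s 0) + p * l (s 0) ≤ z (s 0)) <;>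
          simp [Set.indicator, mem_cell_child hp0 hp1 hl, hz, hb]
      · simp [Set.indicator, mem_cell_child hp0 hp1 hl, hz]
    · rw [hsum fun b i => ∫ z, f b i z * ‖z - x i‖ ^ 2]
      refine (add_le_add (hfc false) (hfc true)).trans (le_of_eq ?_)
      rw [← mul_add, treeCost]
      congr 1
      have hS2 : ∀ c, (S.filter fun i => dyadicCode (K + 1) s q m (x i) 0 = c) = S' c := fun c => rfl
      simp only [hS2]
      rw [← hp]
      congr 1 <;>
      · apply treeCost_congr
        intro i hi
        have hi := (Finset.mem_filter.1 hi).2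
        simp only [hbit] at hi
        simp only [dyadicCode, hi, Fin.tail_cons]

/-! ### Mean cost of the dyadic transport -/

/-- Sum of the squared side lengths of the dyadic boxes after `K` halvings. -/
noncomputable def leafSum {d : ℕ} (K : ℕ) (s : ℕ → Fin d) (m : Fin d → ℝ) : ℝ :=
  ∑ i, (m i * (1 / 2) ^ Nat.count (fun k => s k = i) K) ^ 2

/-- Sum over the steps `k < K` of the mean price of cutting in wrong proportions at step `k`. There
are `2 ^ k` boxes, and in the direction that is cut the mean of the product of the sides
of the two paired boxes has been divided by `4` at each earlier cut in that direction. -/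
noncomputable def splitSum {d : ℕ} (K : ℕ) (s : ℕ → Fin d) (l m : Fin d → ℝ) : ℝ :=
  ∑ k ∈ Finset.range K,
    2 ^ k * (1 / 4) ^ Nat.count (fun k' => s k' = s k) k * (l (s k) * m (s k)) / 6

lemma leafSum_childSide {d : ℕ} (K : ℕ) (s : ℕ → Fin d) (b : Bool) (m : Fin d → ℝ) :
    leafSum K (fun k => s (k + 1)) (childSide b (1 / 2) (s 0) m) = leafSum (K + 1) s m := by
  unfold leafSum
  refine Finset.sum_congr rfl fun i _ => ?_
  rw [Nat.count_succ']
  rcases eq_or_ne (s 0) i with h | h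
  · subst h
    rw [if_pos rfl, childSide, Function.update_self, pow_succ]
    cases b
    · simp only [Bool.false_eq_true, if_false]; ring
    · simp only [if_true]; ring
  · rw [if_neg h, childSide, Function.update_of_ne h.symm, add_zero]

lemma splitSum_succ {d : ℕ} (K : ℕ) (s : ℕ → Fin d) (p : ℝ) (l m : Fin d → ℝ) :
    splitSum (K + 1) s l m = l (s 0) * m (s 0) / 6 +
      (splitSum K (fun k => s (k + 1)) (childSide false p (s 0) l)
        (childSide false (1 / 2) (s 0) m) +
      splitSum K (fun k => s (k + 1)) (childSide true p (s 0) l)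
        (childSide true (1 / 2) (s 0) m)) := by
  unfold splitSum
  rw [Finset.sum_range_succ', add_comm, ← Finset.sum_add_distrib]
  congr 1
  · simp
  · refine Finset.sum_congr rfl fun k _ => ?_
    rw [Nat.count_succ']
    rcases eq_or_ne (s 0) (s (k + 1)) with h | h
    · rw [if_pos h]
      simp only [← h, childSide, Function.update_self, if_true, Bool.false_eq_true, if_false]
      ring
    · rw [if_neg h]
      simp only [childSide, Function.update_of_ne h.symm]
      ring

/-- The bijection which splits off the first digits. -/
def consDigits (ι : Type*) (K : ℕ) :
    (ι → Bool) × (ι → Fin K → Bool) ≃ (ι → Fin (K + 1) → Bool) where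
  toFun e i := Fin.cons (e.1 i) (e.2 i)
  invFun b := (fun i => b i 0, fun i => Fin.tail (b i))
  left_inv e := by ext <;> simp
  right_inv b := by
    funext i
    exact Fin.cons_self_tail (b i)

/-- Mean cost over fair random digits: the linear term of `boxCost_child` averages out, and the
quadratic term costs at most `l m / 6` per cut. -/
lemma expect_treeCost_le {d : ℕ} {ι : Type*} [Fintype ι] [DecidableEq ι] (K : ℕ) :
    ∀ (s : ℕ → Fin d) (S : Finset ι) (a l q m : Fin d → ℝ), (∀ i, 0 ≤ l i) → (∀ i, 0 ≤ m i) →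
      (Finset.univ.expect fun b : ι → Fin K → Bool => treeCost K s S a l q m b) ≤
        S.card * (2 * boxCost a l q m + leafSum K s m) + splitSum K s l m := by
  induction K with
  | zero =>
    intro s S a l q m hl hm
    simp [treeCost, leafSum, splitSum]
  | succ K ih =>
    intro s S a l q m hl hm
    rw [← Fintype.expect_equiv (consDigits ι K)
      (fun e => treeCost (K + 1) s S a l q m (consDigits ι K e)) _ fun _ => rfl,
      ← Finset.univ_product_univ, Finset.expect_product]
    set D := a (s 0) + l (s 0) / 2 - (q (s 0) + m (s 0) / 2) with hD
    set n : ℝ := (S.card : ℝ) with hn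
    set lm := l (s 0) * m (s 0) with hlm
    have hlm0 : 0 ≤ lm := mul_nonneg (hl _) (hm _)
    have step : ∀ ε : ι → Bool, (Finset.univ.expect fun b : ι → Fin K → Bool =>
        treeCost (K + 1) s S a l q m (consDigits ι K (ε, b))) ≤
        n * (2 * boxCost a l q m + leafSum (K + 1) s m) + (splitSum (K + 1) s l m - lm / 6) +
          D * m (s 0) * (∑ i ∈ S, boolSign (ε i)) +
          lm / 6 * (n⁻¹ * (∑ i ∈ S, boolSign (ε i)) ^ 2) := fun ε => by
      set S' : Bool → Finset ι := fun c => S.filter fun i => ε i = c with hS'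
      set p : ℝ := (S' false).card / n with hp
      have hcard : ((S' false).card : ℝ) + (S' true).card = n := by
        rw [← Nat.cast_add, hS', hn]
        have := Finset.card_filter_add_card_filter_not (s := S) (fun i => ε i = false)
        simp only [Bool.not_eq_false] at this
        exact_mod_cast this
      have hpn : (S' false).card = p * n := by
        rcases S.eq_empty_or_nonempty with h0 | h0
        · simp [hn, h0, hS']
        · have : n ≠ 0 := by rw [hn]; exact_mod_cast h0.card_ne_zero
          rw [hp, div_mul_cancel₀ _ this]
      have hqn : ((S' true).card : ℝ) = (1 - p) * n := by linarith
      have hn0 : 0 ≤ n := Nat.cast_nonneg _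
      have hp0 : 0 ≤ p := div_nonneg (Nat.cast_nonneg _) hn0
      have hp1 : p ≤ 1 := div_le_one_of_le₀
        (by rw [← hcard]; linarith [Nat.cast_nonneg (α := ℝ) (S' true).card]) hn0
      have hsign : ∑ i ∈ S, boolSign (ε i) = (2 * p - 1) * n := by
        rw [sum_boolSign]
        change 2 * ((S' false).card : ℝ) - n = _
        rw [hpn]; ring
      have hsq : n⁻¹ * ((2 * p - 1) * n) ^ 2 = (2 * p - 1) ^ 2 * n := by
        rcases eq_or_ne n 0 with h0 | h0
        · simp [h0]
        · field_simp
      have hrec : ∀ b : ι → Fin K → Bool,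
          treeCost (K + 1) s S a l q m (consDigits ι K (ε, b)) =
          treeCost K (fun k => s (k + 1)) (S' false) (childCorner false p (s 0) a l)
            (childSide false p (s 0) l) (childCorner false (1 / 2) (s 0) q m)
            (childSide false (1 / 2) (s 0) m) b +
          treeCost K (fun k => s (k + 1)) (S' true) (childCorner true p (s 0) a l)
            (childSide true p (s 0) l) (childCorner true (1 / 2) (s 0) q m)
            (childSide true (1 / 2) (s 0) m) b := fun b => rfl
      simp only [hrec]
      rw [Finset.expect_add_distrib]
      have hch : ∀ c, _ := fun c => ih (fun k => s (k + 1)) (S' c) (childCorner c p (s 0) a l)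
        (childSide c p (s 0) l) (childCorner c (1 / 2) (s 0) q m)
        (childSide c (1 / 2) (s 0) m) (childSide_nonneg hp0 hp1 hl)
        (childSide_nonneg (by norm_num) (by norm_num) hm)
      refine (add_le_add (hch false) (hch true)).trans (le_of_eq ?_)
      rw [leafSum_childSide, leafSum_childSide, splitSum_succ K s p, hsign, hsq, hpn, hqn, ← hlm]
      have hbox := boxCost_child p (s 0) a l q m
      rw [← hD, ← hlm] at hbox
      linear_combination 2 * n * hbox
    refine (Finset.expect_le_expect fun ε _ => step ε).trans ?_
    simp only [Finset.expect_add_distrib, ← Finset.mul_expect, expect_sum_boolSign,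
      expect_sq_sum_boolSign, Fintype.expect_const]
    rw [mul_zero, add_zero, ← hn]
    have : n⁻¹ * n ≤ 1 := inv_mul_le_one
    nlinarith

/-! ### Law of the dyadic digits -/

/-- All sequences of `K` digits have equal volume. -/
lemma measurableSet_dyadicCode_preimage {d : ℕ} (K : ℕ) (b : Fin K → Bool) :
    ∀ (s : ℕ → Fin d) (q m : Fin d → ℝ), (∀ i, 0 ≤ m i) →
      MeasurableSet (cell q m ∩ dyadicCode K s q m ⁻¹' {b}) ∧
      volume (cell q m ∩ dyadicCode K s q m ⁻¹' {b}) =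
        ENNReal.ofReal ((∏ i, m i) * (1 / 2) ^ K) := by
  induction K with
  | zero =>
    intro s q m hm
    have : cell q m ∩ dyadicCode 0 s q m ⁻¹' {b} = cell q m := by
      ext x; simp [Subsingleton.elim (dyadicCode 0 s q m x) b]
    rw [this, volume_cell hm]
    exact ⟨measurableSet_cell q m, by simp⟩
  | succ K ih =>
    intro s q m hm
    have : cell q m ∩ dyadicCode (K + 1) s q m ⁻¹' {b} =
        cell (childCorner (b 0) (1 / 2) (s 0) q m) (childSide (b 0) (1 / 2) (s 0) m) ∩
        dyadicCode K (fun k => s (k + 1)) (childCorner (b 0) (1 / 2) (s 0) q m)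
          (childSide (b 0) (1 / 2) (s 0) m) ⁻¹' {Fin.tail b} := by
      ext x
      simp only [Set.mem_inter_iff, Set.mem_preimage, Set.mem_singleton_iff,
        mem_cell_child (by norm_num : (0 : ℝ) ≤ 1 / 2) (by norm_num) hm, and_assoc]
      refine and_congr_right fun _ => ?_
      conv_lhs => rw [← Fin.cons_self_tail b]
      simp only [dyadicCode, Fin.cons_inj]
      exact and_congr_right fun h => by rw [h]
    rw [this]
    obtain ⟨h1, h2⟩ := ih (Fin.tail b) (fun k => s (k + 1))
      (childCorner (b 0) (1 / 2) (s 0) q m) (childSide (b 0) (1 / 2) (s 0) m)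
      (childSide_nonneg (by norm_num) (by norm_num) hm)
    refine ⟨h1, h2.trans ?_⟩
    rw [prod_childSide, pow_succ]
    congr 1
    split_ifs <;> ring

/-! ### Upper bound -/

/-- Composing the two transports of `exists_densities` through the Lebesgue measure. -/
lemma matchingCost_le_treeCost {d N : ℕ} (hN : 1 ≤ N) (K : ℕ) (s : ℕ → Fin d)
    {x y : Fin N → EuclideanSpace ℝ (Fin d)} (hx : ∀ n, x n ∈ cell (fun _ => 0) (fun _ => 1))
    (hy : ∀ n, y n ∈ cell (fun _ => 0) (fun _ => 1)) :
    matchingCost x y ≤ 2 / (N : ℝ) *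
      (treeCost K s Finset.univ (fun _ => 0) (fun _ => 1) (fun _ => 0) (fun _ => 1)
          (fun n => dyadicCode K s (fun _ => 0) (fun _ => 1) (x n)) +
        treeCost K s Finset.univ (fun _ => 0) (fun _ => 1) (fun _ => 0) (fun _ => 1)
          (fun n => dyadicCode K s (fun _ => 0) (fun _ => 1) (y n))) := by
  have hN0 : (0 : ℝ) < N := by exact_mod_cast hN
  have hc : (0 : ℝ) < 1 / N := by positivity
  set Q : Set (EuclideanSpace ℝ (Fin d)) := cell (fun _ => 0) (fun _ => 1) with hQ
  have hex : ∀ v : Fin N → EuclideanSpace ℝ (Fin d), (∀ n, v n ∈ Q) → _ := fun v hv =>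
    exists_densities hc v K s Finset.univ (fun _ => 0) (fun _ => 1) (fun _ => 0) (fun _ => 1)
      (fun _ => zero_le_one) (fun _ => zero_le_one) (by simp [hN0.ne']) fun i _ => hv i
  obtain ⟨f, hfm, hf0, hfs, hfi, hfc⟩ := hex x hx
  obtain ⟨g, hgm, hg0, hgs, hgi, hgc⟩ := hex y hy
  replace hfs : ∀ z, ∑ i, f i z = Q.indicator 1 z := hfs
  replace hgs : ∀ z, ∑ i, g i z = Q.indicator 1 z := hgs
  have hQbox : Q ⊆ box d 1 := fun z hz i => by
    have := hz i
    rw [Set.mem_Ico, zero_add] at this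
    exact ⟨this.1, this.2.le⟩
  have hQfin : volume Q ≠ ⊤ := by
    rw [hQ, volume_cell fun _ => zero_le_one]; exact ENNReal.ofReal_ne_top
  have hle : ∀ f : Fin N → EuclideanSpace ℝ (Fin d) → ℝ, (∀ i z, 0 ≤ f i z) →
      (∀ z, ∑ i, f i z = Q.indicator 1 z) → ∀ i z, f i z ≤ Q.indicator 1 z := fun f h0 hs i z => by
    rw [← hs z]
    exact Finset.single_le_sum (fun j _ => h0 j z) (Finset.mem_univ i)
  have hf1 := hle f hf0 hfs
  have hg1 := hle g hg0 hgs
  have hint : ∀ (h : EuclideanSpace ℝ (Fin d) → ℝ) (C : ℝ), Measurable h → (∀ z, 0 ≤ h z) →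
      (∀ z, h z ≤ Q.indicator (fun _ => C) z) → Integrable h := fun h C hm h0 h1 =>
    Integrable.mono' ((integrable_indicator_iff (measurableSet_cell _ _)).2
      (integrableOn_const hQfin)) hm.aestronglyMeasurable
      (Filter.Eventually.of_forall fun z => by rw [Real.norm_of_nonneg (h0 z)]; exact h1 z)
  have hmul : ∀ u z, 0 ≤ u → u ≤ Q.indicator (1 : EuclideanSpace ℝ (Fin d) → ℝ) z → u * Q.indicator 1 z = u :=
    fun u z h0 h1 => by
      by_cases hz : z ∈ Q
      · simp [hz]
      · rw [Set.indicator_of_notMem hz] at h1 ⊢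
        rw [mul_zero]; exact le_antisymm h0 h1
  have hfg : ∀ i j, Integrable fun z => f i z * g j z := fun i j =>
    hint _ 1 ((hfm i).mul (hgm j)) (fun z => mul_nonneg (hf0 i z) (hg0 j z)) fun z => by
      have h1 := hf1 i z
      have h2 := hg1 j z
      by_cases hz : z ∈ Q
      · simp only [hz, Set.indicator_of_mem, Pi.one_apply] at h1 h2 ⊢
        exact mul_le_one₀ h1 (hg0 j z) h2
      · simp only [hz, Set.indicator_of_notMem, not_false_eq_true] at h1 h2 ⊢
        rw [le_antisymm h1 (hf0 i z), zero_mul]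
  have hfn : ∀ f : EuclideanSpace ℝ (Fin d) → ℝ, Measurable f → (∀ z, 0 ≤ f z) →
      (∀ z, f z ≤ Q.indicator 1 z) → ∀ v ∈ Q, Integrable fun z => f z * ‖z - v‖ ^ 2 :=
    fun f hm h0 h1 v hv => by
      refine hint _ d (hm.mul (by fun_prop)) (fun z => mul_nonneg (h0 z) (by positivity))
        fun z => ?_
      have h1 := h1 z
      by_cases hz : z ∈ Q
      · simp only [hz, Set.indicator_of_mem, Pi.one_apply] at h1 ⊢
        have := norm_sq_sub_le_of_mem_box (hQbox hv) (hQbox hz)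
        nlinarith [h0 z, sq_nonneg ‖z - v‖]
      · simp only [hz, Set.indicator_of_notMem, not_false_eq_true] at h1 ⊢
        rw [le_antisymm h1 (h0 z), zero_mul]
  have hM : Matrix.of (fun i j => (N : ℝ) * ∫ z, f i z * g j z) ∈ doublyStochastic ℝ (Fin N) := by
    rw [mem_doublyStochastic_iff_sum]
    refine ⟨fun i j => ?_, fun i => ?_, fun j => ?_⟩
    · exact mul_nonneg hN0.le (integral_nonneg fun z => mul_nonneg (hf0 i z) (hg0 j z))
    · simp only [Matrix.of_apply]
      rw [← Finset.mul_sum, ← integral_finsetSum _ fun j _ => hfg i j]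
      simp only [← Finset.mul_sum, hgs, hmul _ _ (hf0 i _) (hf1 i _), hfi i (Finset.mem_univ i)]
      field_simp
    · simp only [Matrix.of_apply]
      rw [← Finset.mul_sum, ← integral_finsetSum _ fun i _ => hfg i j]
      simp only [← Finset.sum_mul, hfs]
      simp only [mul_comm (Q.indicator _ _), hmul _ _ (hg0 j _) (hg1 j _),
        hgi j (Finset.mem_univ j)]
      field_simp
  refine (matchingCost_le_of_doublyStochastic x y hM).trans ?_
  simp only [Matrix.of_apply]
  calc (1 / (N : ℝ)) * ∑ i, ∑ j, (N : ℝ) * (∫ z, f i z * g j z) * ‖y j - x i‖ ^ 2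
      = ∫ z, ∑ i, ∑ j, f i z * g j z * ‖y j - x i‖ ^ 2 := by
        rw [integral_finsetSum _ fun i _ => integrable_finsetSum _ fun j _ =>
          (hfg i j).mul_const _, Finset.mul_sum]
        refine Finset.sum_congr rfl fun i _ => ?_
        rw [integral_finsetSum _ fun j _ => (hfg i j).mul_const _, Finset.mul_sum]
        refine Finset.sum_congr rfl fun j _ => ?_
        rw [integral_mul_const]
        field_simp
    _ ≤ ∫ z, (2 * ∑ i, f i z * ‖z - x i‖ ^ 2 + 2 * ∑ j, g j z * ‖z - y j‖ ^ 2) := by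
        have hIf := integrable_finsetSum Finset.univ fun i _ =>
          hfn (f i) (hfm i) (hf0 i) (hf1 i) (x i) (hx i)
        have hIg := integrable_finsetSum Finset.univ fun i _ =>
          hfn (g i) (hgm i) (hg0 i) (hg1 i) (y i) (hy i)
        refine integral_mono (integrable_finsetSum _ fun i _ => integrable_finsetSum _ fun j _ =>
          (hfg i j).mul_const _) ((hIf.const_mul 2).add (hIg.const_mul 2)) fun z => ?_
        dsimp only
        have e1 : ∑ i, f i z * ‖z - x i‖ ^ 2 =
            ∑ i, ∑ j, f i z * g j z * ‖z - x i‖ ^ 2 := Finset.sum_congr rfl fun i _ => by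
          rw [← Finset.sum_mul, ← Finset.mul_sum, hgs, hmul _ _ (hf0 i z) (hf1 i z)]
        have e2 : ∑ j, g j z * ‖z - y j‖ ^ 2 =
            ∑ i, ∑ j, f i z * g j z * ‖z - y j‖ ^ 2 := by
          rw [Finset.sum_comm]
          refine Finset.sum_congr rfl fun j _ => ?_
          rw [← Finset.sum_mul, ← Finset.sum_mul, hfs, mul_comm (Q.indicator _ _),
            hmul _ _ (hg0 j z) (hg1 j z)]
        rw [e1, e2, Finset.mul_sum, Finset.mul_sum, ← Finset.sum_add_distrib]
        refine Finset.sum_le_sum fun i _ => ?_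
        rw [Finset.mul_sum, Finset.mul_sum, ← Finset.sum_add_distrib]
        refine Finset.sum_le_sum fun j _ => ?_
        have h1 : ‖y j - x i‖ ≤ ‖z - x i‖ + ‖z - y j‖ := by
          rw [norm_sub_rev z (y j), add_comm]
          exact norm_sub_le_norm_sub_add_norm_sub (y j) z (x i)
        have h2 : ‖y j - x i‖ ^ 2 ≤ 2 * ‖z - x i‖ ^ 2 + 2 * ‖z - y j‖ ^ 2 := by
          nlinarith [norm_nonneg (y j - x i), sq_nonneg (‖z - x i‖ - ‖z - y j‖)]
        nlinarith [mul_le_mul_of_nonneg_left h2 (mul_nonneg (hf0 i z) (hg0 j z))]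
    _ = 2 * (∑ i, ∫ z, f i z * ‖z - x i‖ ^ 2) + 2 * ∑ j, ∫ z, g j z * ‖z - y j‖ ^ 2 := by
        have hIf := fun i => hfn (f i) (hfm i) (hf0 i) (hf1 i) (x i) (hx i)
        have hIg := fun i => hfn (g i) (hgm i) (hg0 i) (hg1 i) (y i) (hy i)
        rw [integral_add ((integrable_finsetSum _ fun i _ => hIf i).const_mul 2)
          ((integrable_finsetSum _ fun i _ => hIg i).const_mul 2), integral_const_mul,
          integral_const_mul, integral_finsetSum _ fun i _ => hIf i,
          integral_finsetSum _ fun i _ => hIg i]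
    _ ≤ _ := by
        have h1 := mul_le_mul_of_nonneg_left hfc zero_le_two
        have h2 := mul_le_mul_of_nonneg_left hgc zero_le_two
        refine (add_le_add h1 h2).trans (le_of_eq ?_)
        ring

lemma restrict_box_eq_restrict_cell (d : ℕ) :
    (volume : Measure (EuclideanSpace ℝ (Fin d))).restrict (box d 1) =
      volume.restrict (cell (fun _ => 0) (fun _ => 1)) := by
  have hsub : cell (fun _ : Fin d => (0 : ℝ)) (fun _ => 1) ⊆ box d 1 := fun z hz i => by
    have := hz i
    rw [Set.mem_Ico, zero_add] at this
    exact ⟨this.1, this.2.le⟩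
  refine (Measure.restrict_congr_set ?_).symm
  refine ae_eq_of_subset_of_measure_ge hsub ?_ (measurableSet_cell _ _).nullMeasurableSet ?_
  · rw [volume_box zero_le_one, volume_cell fun _ => zero_le_one]; simp
  · rw [volume_box zero_le_one]; exact ENNReal.ofReal_ne_top

lemma ae_mem_unit_cell {d : ℕ} {Ω : Type*} [MeasurableSpace Ω] {P : Measure Ω}
    {X : Ω → EuclideanSpace ℝ (Fin d)} (hX : Measurable X)
    (h : P.map X = volume.restrict (box d 1)) :
    ∀ᵐ ω ∂P, X ω ∈ cell (fun _ => 0) (fun _ => 1) := by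
  refine ae_of_ae_map hX.aemeasurable ?_
  rw [h, restrict_box_eq_restrict_cell]
  exact ae_restrict_mem (measurableSet_cell _ _)

/-- The dyadic digits of independent uniform points are independent and fair. -/
lemma integral_comp_dyadicCode {d N K : ℕ} {s : ℕ → Fin d} {Ω : Type*} [MeasurableSpace Ω]
    {P : Measure Ω} [IsProbabilityMeasure P] {X : Fin N → Ω → EuclideanSpace ℝ (Fin d)}
    (hX : ∀ n, Measurable (X n)) (hind : iIndepFun X P)
    (hXl : ∀ n, P.map (X n) = volume.restrict (box d 1)) (F : (Fin N → Fin K → Bool) → ℝ) :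
    Integrable (fun ω => F fun n => dyadicCode K s (fun _ => 0) (fun _ => 1) (X n ω)) P ∧
      ∫ ω, F (fun n => dyadicCode K s (fun _ => 0) (fun _ => 1) (X n ω)) ∂P =
        Finset.univ.expect F := by
  set Q : Set (EuclideanSpace ℝ (Fin d)) := cell (fun _ => 0) (fun _ => 1) with hQ
  set B : (Fin K → Bool) → Set (EuclideanSpace ℝ (Fin d)) := fun b =>
    Q ∩ dyadicCode K s (fun _ => 0) (fun _ => 1) ⁻¹' {b} with hB
  have hBm : ∀ b, MeasurableSet (B b) := fun b =>
    (measurableSet_dyadicCode_preimage K b s _ _ fun _ => zero_le_one).1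
  set A : (Fin N → Fin K → Bool) → Set Ω := fun b => ⋂ n, X n ⁻¹' B (b n) with hA
  have hAm : ∀ b, MeasurableSet (A b) := fun b => MeasurableSet.iInter fun n => hX n (hBm _)
  have hBsub : ∀ b, B b ⊆ box d 1 := fun b z hz i => by
    have := hz.1 i
    rw [Set.mem_Ico, zero_add] at this
    exact ⟨this.1, this.2.le⟩
  have hAP : ∀ b, P.real (A b) = ((1 / 2) ^ K) ^ N := fun b => by
    have h := hind.measure_inter_preimage_eq_mul Finset.univ (sets := fun n => B (b n))
      fun n _ => hBm _
    simp only [Finset.mem_univ, Set.iInter_true] at h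
    rw [Measure.real, hA, h, ENNReal.toReal_prod]
    have h1 : ∀ n, (P (X n ⁻¹' B (b n))).toReal = (1 / 2) ^ K := fun n => by
      rw [← Measure.map_apply (hX n) (hBm _), hXl, Measure.restrict_apply (hBm _),
        Set.inter_eq_left.2 (hBsub _),
        (measurableSet_dyadicCode_preimage K (b n) s _ _ fun _ => zero_le_one).2,
        ENNReal.toReal_ofReal (by positivity)]
      simp
    simp [h1]
  have hae : (fun ω => F fun n => dyadicCode K s (fun _ => 0) (fun _ => 1) (X n ω)) =ᵐ[P]
      fun ω => ∑ b, (A b).indicator (fun _ => F b) ω := by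
    filter_upwards [ae_all_iff.2 fun n => ae_mem_unit_cell (hX n) (hXl n)] with ω hω
    rw [Finset.sum_eq_single fun n => dyadicCode K s (fun _ => 0) (fun _ => 1) (X n ω)]
    · rw [Set.indicator_of_mem]
      exact Set.mem_iInter.2 fun n => ⟨hω n, rfl⟩
    · intro b _ hb
      rw [Set.indicator_of_notMem]
      intro h
      exact hb (funext fun n => ((Set.mem_iInter.1 h n).2).symm)
    · simp
  have hI : ∀ b, Integrable ((A b).indicator fun _ => F b) P := fun b =>
    (integrable_const _).indicator (hAm b)
  refine ⟨(integrable_finsetSum _ fun b _ => hI b).congr hae.symm, ?_⟩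
  rw [integral_congr_ae hae, integral_finsetSum _ fun b _ => hI b]
  simp only [integral_indicator_const _ (hAm _), hAP, smul_eq_mul]
  rw [← Finset.mul_sum, Finset.expect_eq_sum_div_card]
  simp [div_eq_inv_mul]

lemma integral_matchingCost_le_leafSum_add_splitSum {d N : ℕ} (hN : 1 ≤ N) (K : ℕ)
    (s : ℕ → Fin d) {Ω : Type*} [MeasurableSpace Ω]
    {P : Measure Ω} [IsProbabilityMeasure P] {X Y : Fin N → Ω → EuclideanSpace ℝ (Fin d)}
    (hX : ∀ n, Measurable (X n)) (hY : ∀ n, Measurable (Y n))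
    (hind : iIndepFun (Sum.elim X Y) P)
    (hXl : ∀ n, P.map (X n) = volume.restrict (box d 1))
    (hYl : ∀ n, P.map (Y n) = volume.restrict (box d 1)) :
    ∫ ω, matchingCost (fun n => X n ω) (fun n => Y n ω) ∂P ≤
      4 * leafSum K s (fun _ => 1) + 4 / N * splitSum K s (fun _ => 1) (fun _ => 1) := by
  have hN0 : (0 : ℝ) < N := by exact_mod_cast hN
  set F : (Fin N → Fin K → Bool) → ℝ := fun b =>
    treeCost K s Finset.univ (fun _ => 0) (fun _ => 1) (fun _ => 0) (fun _ => 1) b with hF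
  have hx := integral_comp_dyadicCode hX (hind.precomp (g := Sum.inl) Sum.inl_injective) hXl F (s := s)
  have hy := integral_comp_dyadicCode hY (hind.precomp (g := Sum.inr) Sum.inr_injective) hYl F (s := s)
  have hE := expect_treeCost_le K s (Finset.univ : Finset (Fin N)) (fun _ => 0) (fun _ => 1)
    (fun _ => 0) (fun _ => 1) (fun _ => zero_le_one) (fun _ => zero_le_one)
  rw [boxCost_self, Finset.card_univ, Fintype.card_fin] at hE
  calc _ ≤ ∫ ω, 2 / (N : ℝ) *
        (F (fun n => dyadicCode K s (fun _ => 0) (fun _ => 1) (X n ω)) +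
          F (fun n => dyadicCode K s (fun _ => 0) (fun _ => 1) (Y n ω))) ∂P := by
        refine integral_mono_ae (integrable_matchingCost hX hY hXl hYl)
          ((hx.1.add hy.1).const_mul _) ?_
        filter_upwards [ae_all_iff.2 fun n => ae_mem_unit_cell (hX n) (hXl n),
          ae_all_iff.2 fun n => ae_mem_unit_cell (hY n) (hYl n)] with ω h1 h2
        exact matchingCost_le_treeCost hN K s h1 h2
    _ = 2 / N * (2 * Finset.univ.expect F) := by
        rw [integral_const_mul, integral_add hx.1 hy.1, hx.2, hy.2]; ring
    _ ≤ 2 / N * (2 * (N * (2 * 0 + leafSum K s (fun _ => 1)) +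
          splitSum K s (fun _ => 1) (fun _ => 1))) := by gcongr
    _ = _ := by field_simp; ring

/-! ### The number of halvings -/

/-- The directions in cyclic order. -/
def cyclicDir {d : ℕ} (hd : 0 < d) (k : ℕ) : Fin d := ⟨k % d, Nat.mod_lt k hd⟩

lemma leafSum_cyclicDir {d : ℕ} (hd : 0 < d) (m : ℕ) :
    leafSum (d * m) (cyclicDir hd) (fun _ => 1) = d * (1 / 2 ^ m) ^ 2 := by
  have h : ∀ i : Fin d, Nat.count (fun k => cyclicDir hd k = i) (d * m) = m := fun i => by
    have h1 : ∀ k, cyclicDir hd k = i ↔ k ≡ i [MOD d] := fun k => by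
      rw [cyclicDir, Fin.ext_iff, Nat.ModEq, Nat.mod_eq_of_lt i.2]
    simp only [h1]
    rw [Nat.count_modEq_card _ hd]
    simp [hd]
  unfold leafSum
  simp [h]

lemma splitSum_cyclicDir_le {d : ℕ} (hd : 0 < d) (m : ℕ) :
    splitSum (d * m) (cyclicDir hd) (fun _ => 1) (fun _ => 1) ≤
      2 ^ d * ∑ q ∈ Finset.range m, 2 ^ (d * q) * (1 / 4 : ℝ) ^ q := by
  have h : ∀ k, Nat.count (fun k' => cyclicDir hd k' = cyclicDir hd k) k = k / d := fun k => by
    have h1 : ∀ k', cyclicDir hd k' = cyclicDir hd k ↔ k' ≡ k [MOD d] := fun k' => by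
      rw [cyclicDir, cyclicDir, Fin.ext_iff, Nat.ModEq]
    simp only [h1]
    rw [Nat.count_modEq_card _ hd]
    simp
  unfold splitSum
  simp only [h]
  induction m with
  | zero => simp
  | succ m ih =>
    rw [Nat.mul_succ, Finset.sum_range_add, Finset.sum_range_succ, mul_add]
    refine add_le_add ih ?_
    have h2 : ∀ r ∈ Finset.range d,
        2 ^ (d * m + r) * (1 / 4 : ℝ) ^ ((d * m + r) / d) * (1 * 1) / 6 =
        2 ^ (d * m) * (1 / 4) ^ m / 6 * 2 ^ r := fun r hr => by
      rw [Nat.mul_add_div hd, Nat.div_eq_of_lt (Finset.mem_range.1 hr), add_zero, pow_add]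
      ring
    rw [Finset.sum_congr rfl h2, ← Finset.mul_sum, geom_sum_eq (by norm_num)]
    have : (0 : ℝ) ≤ 2 ^ (d * m) * (1 / 4) ^ m := by positivity
    have h3 : (1 : ℝ) ≤ 2 ^ d := one_le_pow₀ (by norm_num)
    have h4 := mul_nonneg this (by linarith : (0 : ℝ) ≤ 2 ^ d)
    norm_num1
    nlinarith

lemma microScale_one_bounds {d N : ℕ} (hd : 0 < d) (hN : 1 ≤ N) :
    1 / 2 ^ Nat.log (2 ^ d) N ≤ 2 * microScale d 1 N ∧
      microScale d 1 N ≤ 1 / 2 ^ Nat.log (2 ^ d) N ∧ microScale d 1 N ^ d = 1 / N ∧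
      0 < microScale d 1 N := by
  have hN0 : (0 : ℝ) < N := by exact_mod_cast hN
  set m := Nat.log (2 ^ d) N
  have hpos : 0 < microScale d 1 N := by unfold microScale; positivity
  have hpow : microScale d 1 N ^ d = 1 / N := by
    unfold microScale
    rw [one_mul, ← Real.rpow_natCast, ← Real.rpow_mul hN0.le]
    have : -(1 / (d : ℝ)) * d = -1 := by field_simp
    rw [this, Real.rpow_neg_one, one_div]
  have h1 : ((2 : ℝ) ^ m) ^ d ≤ N := by
    rw [← pow_mul, mul_comm, pow_mul]
    exact_mod_cast Nat.pow_log_le_self (2 ^ d) (by omega)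
  have h2 : (N : ℝ) < ((2 : ℝ) ^ (m + 1)) ^ d := by
    rw [← pow_mul, mul_comm, pow_mul]
    exact_mod_cast Nat.lt_pow_succ_log_self (Nat.one_lt_two_pow hd.ne') N
  refine ⟨?_, ?_, hpow, hpos⟩
  · have h3 : (1 / 2 ^ (m + 1) : ℝ) ^ d ≤ microScale d 1 N ^ d := by
      rw [hpow, one_div_pow]
      exact one_div_le_one_div_of_le hN0 h2.le
    have := le_of_pow_le_pow_left₀ hd.ne' hpos.le h3
    have h5 : (1 / 2 ^ m : ℝ) = 2 * (1 / 2 ^ (m + 1)) := by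
      rw [pow_succ]; field_simp
    linarith
  · have h3 : microScale d 1 N ^ d ≤ (1 / 2 ^ m : ℝ) ^ d := by
      rw [hpow, one_div_pow]
      exact one_div_le_one_div_of_le (by positivity) h1
    exact le_of_pow_le_pow_left₀ hd.ne' (by positivity) h3

/-- With as many rounds of halvings as leave about one point per dyadic box, the dyadic transport
has the cost claimed in every dimension. -/
lemma exists_leafSum_add_splitSum_le {d : ℕ} (hd : 0 < d) :
    ∃ C : ℝ, 0 < C ∧ ∀ N : ℕ, 1 ≤ N → (d = 2 → 2 ≤ N) →
      4 * leafSum (d * Nat.log (2 ^ d) N) (cyclicDir hd) (fun _ => 1) +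
        4 / N * splitSum (d * Nat.log (2 ^ d) N) (cyclicDir hd) (fun _ => 1) (fun _ => 1) ≤
      C * (microScale d 1 N * matchingRate d N) ^ 2 := by
  refine ⟨32 * d + 16 * 2 ^ d, by positivity, fun N hN hN2 => ?_⟩
  have hN0 : (0 : ℝ) < N := by exact_mod_cast hN
  have hN1 : (1 : ℝ) ≤ N := by exact_mod_cast hN
  obtain ⟨h1, h2, h3, h4⟩ := microScale_one_bounds hd hN
  have hlogle : (2 ^ (d * Nat.log (2 ^ d) N) : ℝ) ≤ N := by
    rw [pow_mul]
    exact_mod_cast Nat.pow_log_le_self (2 ^ d) (by omega)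
  rw [leafSum_cyclicDir]
  have hS := splitSum_cyclicDir_le hd (Nat.log (2 ^ d) N)
  set m := Nat.log (2 ^ d) N
  set ρ := microScale d 1 N
  set S := splitSum (d * m) (cyclicDir hd) (fun _ => 1) (fun _ => 1)
  have hleaf : (1 / 2 ^ m : ℝ) ^ 2 ≤ 4 * ρ ^ 2 := by
    have := pow_le_pow_left₀ (by positivity) h1 2
    rw [mul_pow] at this; linarith
  -- It is enough to bound the geometric sum and to know that `1` is below twice the squared rate.
  suffices H : ∑ q ∈ Finset.range m, 2 ^ (d * q) * (1 / 4 : ℝ) ^ q ≤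
      4 * N * (ρ * matchingRate d N) ^ 2 ∧ ρ ^ 2 ≤ 2 * (ρ * matchingRate d N) ^ 2 by
    have e1 : 4 / N * S ≤ 16 * 2 ^ d * (ρ * matchingRate d N) ^ 2 := by
      calc 4 / N * S ≤ 4 / N * (2 ^ d * (4 * N * (ρ * matchingRate d N) ^ 2)) := by
            gcongr
            exact hS.trans (mul_le_mul_of_nonneg_left H.1 (by positivity))
        _ = _ := by field_simp; ring
    have e2 : 4 * (d * (1 / 2 ^ m : ℝ) ^ 2) ≤ 32 * d * (ρ * matchingRate d N) ^ 2 := by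
      calc 4 * (d * (1 / 2 ^ m : ℝ) ^ 2) ≤
          4 * (d * (4 * (2 * (ρ * matchingRate d N) ^ 2))) := by
            gcongr
            exact hleaf.trans (mul_le_mul_of_nonneg_left H.2 (by norm_num))
        _ = _ := by ring
    linarith
  rw [mul_pow]
  have hterm : ∀ q, 2 ^ (d * q) * (1 / 4 : ℝ) ^ q = (2 ^ d / 4) ^ q := fun q => by
    rw [pow_mul, ← mul_pow]; ring
  simp only [hterm]
  rcases (by omega : d = 1 ∨ d = 2 ∨ 3 ≤ d) with rfl | rfl | hd3
  · have hr : matchingRate 1 N ^ 2 = N := by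
      rw [matchingRate, if_pos rfl, Real.sq_sqrt hN0.le]
    rw [hr]
    rw [pow_one] at h3
    constructor
    · rw [geom_sum_eq (by norm_num)]
      have : (0 : ℝ) ≤ (2 ^ 1 / 4) ^ m := by positivity
      have h5 : 4 * (N : ℝ) * (ρ ^ 2 * N) = 4 := by rw [h3]; field_simp
      rw [h5, div_le_iff_of_neg (by norm_num)]
      linarith
    · nlinarith [sq_nonneg ρ]
  · have hN2' : (2 : ℝ) ≤ N := by exact_mod_cast hN2 rfl
    have hlog : 0.5 ≤ Real.log N :=
      le_trans (by linarith [Real.log_two_gt_d9]) (Real.log_le_log (by norm_num) hN2')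
    have hr : matchingRate 2 N ^ 2 = Real.log N := by
      rw [matchingRate, if_neg (by norm_num), if_pos rfl, Real.sq_sqrt (by linarith)]
    rw [hr, h3]
    constructor
    · have hm : (m : ℝ) ≤ 4 * Real.log N := by
        have h5 := Real.log_le_log (by positivity) hlogle
        rw [Real.log_pow] at h5
        push_cast at h5
        have h6 : (0 : ℝ) ≤ m := Nat.cast_nonneg m
        nlinarith [Real.log_two_gt_d9]
      norm_num
      calc (m : ℝ) ≤ 4 * Real.log N := hm
        _ = _ := by field_simp
    · have : (0 : ℝ) < 1 / N := by positivity
      nlinarith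
  · have hr : matchingRate d N ^ 2 = 1 := by
      rw [matchingRate, if_neg (by omega), if_neg (by omega)]; norm_num
    rw [hr]
    refine ⟨?_, by nlinarith [sq_nonneg ρ]⟩
    have h8 : (2 : ℝ) ≤ 2 ^ d / 4 := by
      have : (2 : ℝ) ^ 3 ≤ 2 ^ d := pow_le_pow_right₀ (by norm_num) hd3
      linarith
    rw [geom_sum_eq (by linarith)]
    have h9 : (0 : ℝ) ≤ (2 ^ d / 4) ^ m := by positivity
    have h10 : ((2 ^ d / 4 : ℝ) ^ m - 1) / (2 ^ d / 4 - 1) ≤ (2 ^ d / 4) ^ m := by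
      rw [div_le_iff₀ (by linarith)]
      nlinarith
    refine h10.trans ?_
    have h11 : (2 ^ d / 4 : ℝ) ^ m = 2 ^ (d * m) * (1 / 2 ^ m) ^ 2 := by
      have h12 : (4 : ℝ) ^ m = (2 ^ m) ^ 2 := by
        rw [← pow_mul, mul_comm m 2, pow_mul]; norm_num
      rw [div_pow, pow_mul, one_div_pow, h12, mul_one_div]
    rw [h11]
    calc (2 : ℝ) ^ (d * m) * (1 / 2 ^ m) ^ 2 ≤ N * (4 * ρ ^ 2) := by gcongr
      _ = _ := by ring

lemma exists_integral_matchingCost_le {d : ℕ} (hd : 0 < d) :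
    ∃ C : ℝ, 0 < C ∧ ∀ N : ℕ, 1 ≤ N → (d = 2 → 2 ≤ N) →
      ∀ (Ω : Type*) [MeasurableSpace Ω] (P : Measure Ω) [IsProbabilityMeasure P]
        (X Y : Fin N → Ω → EuclideanSpace ℝ (Fin d)),
        (∀ n, Measurable (X n)) → (∀ n, Measurable (Y n)) →
        iIndepFun (Sum.elim X Y) P →
        (∀ n, P.map (X n) = volume.restrict (box d 1)) →
        (∀ n, P.map (Y n) = volume.restrict (box d 1)) →
        ∫ ω, matchingCost (fun n => X n ω) (fun n => Y n ω) ∂P ≤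
          C * (microScale d 1 N * matchingRate d N) ^ 2 := by
  obtain ⟨C, hC, h⟩ := exists_leafSum_add_splitSum_le hd
  refine ⟨C, hC, fun N hN hN2 Ω _ P _ X Y hX hY hind hXl hYl => ?_⟩
  exact (integral_matchingCost_le_leafSum_add_splitSum hN _ _ hX hY hind hXl hYl).trans (h N hN hN2)

/-! ### Moments of sums of independent bounded variables -/

lemma integral_sq_sum_of_iIndepFun {Ω ι : Type*} [MeasurableSpace Ω] [Fintype ι] {P : Measure Ω}
    [IsProbabilityMeasure P] {W : ι → Ω → ℝ} (hm : ∀ i, Measurable (W i)) (hind : iIndepFun W P)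
    (hb : ∀ i, ∀ᵐ ω ∂P, |W i ω| ≤ 1) (h0 : ∀ i, ∫ ω, W i ω ∂P = 0) :
    ∫ ω, (∑ i, W i ω) ^ 2 ∂P = ∑ i, ∫ ω, W i ω ^ 2 ∂P := by
  have hL : ∀ i, MemLp (W i) 2 P := fun i =>
    MemLp.of_bound (hm i).aestronglyMeasurable 1 (hb i)
  have h := IndepFun.variance_sum (s := Finset.univ) (fun i _ => hL i)
    (fun i _ j _ hij => hind.indepFun hij)
  have hS : ∫ ω, (∑ i, W i) ω ∂P = 0 := by
    simp only [Finset.sum_apply]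
    rw [integral_finsetSum _ fun i _ => (hL i).integrable (by norm_num)]
    simp [h0]
  rw [variance_of_integral_eq_zero (Finset.aemeasurable_sum _ fun i _ => (hm i).aemeasurable) hS]
    at h
  simp only [variance_of_integral_eq_zero (hm _).aemeasurable (h0 _)] at h
  simpa using h

/-- The sum is sub-Gaussian with variance proxy `n`, and the fourth power is dominated by the
exponential moments at `±1/√n`. -/
lemma integral_pow_four_sum_le {Ω ι : Type*} [MeasurableSpace Ω] [Fintype ι] [Nonempty ι]
    {P : Measure Ω} [IsProbabilityMeasure P] {W : ι → Ω → ℝ} (hm : ∀ i, Measurable (W i))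
    (hind : iIndepFun W P) (hb : ∀ i, ∀ᵐ ω ∂P, |W i ω| ≤ 1) (h0 : ∀ i, ∫ ω, W i ω ∂P = 0) :
    ∫ ω, (∑ i, W i ω) ^ 4 ∂P ≤ 96 * (Fintype.card ι : ℝ) ^ 2 := by
  set n : ℝ := (Fintype.card ι : ℝ) with hn
  have hn0 : 0 < n := by rw [hn]; exact_mod_cast Fintype.card_pos
  have hsub : ∀ i ∈ (Finset.univ : Finset ι), HasSubgaussianMGF (W i) 1 P := fun i _ => by
    have := hasSubgaussianMGF_of_mem_Icc_of_integral_eq_zero (hm i).aemeasurable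
      ((hb i).mono fun ω h => abs_le.1 h) (h0 i)
    convert this using 1
    ext
    norm_num
  have hS := HasSubgaussianMGF.sum_of_iIndepFun hind hsub
  have hmgf : ∀ t : ℝ, ∫ ω, Real.exp (t * ∑ i, W i ω) ∂P ≤ Real.exp (n * t ^ 2 / 2) := fun t => by
    have := hS.mgf_le t
    simpa [mgf, hn] using this
  have hint : ∀ t : ℝ, Integrable (fun ω => Real.exp (t * ∑ i, W i ω)) P :=
    fun t => hS.integrable_exp_mul t
  set t : ℝ := (√n)⁻¹ with ht
  have ht2 : n * t ^ 2 = 1 := by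
    rw [ht, inv_pow, Real.sq_sqrt hn0.le]; field_simp
  have hpt : ∀ u : ℝ, u ^ 4 ≤ 24 * n ^ 2 * (Real.exp (t * u) + Real.exp (-t * u)) := fun u => by
    have h1 : ∀ v : ℝ, v ^ 4 ≤ 24 * (Real.exp v + Real.exp (-v)) := by
      have h2 : ∀ v : ℝ, 0 ≤ v → v ^ 4 ≤ 24 * Real.exp v := fun v hv => by
        have h3 := Real.pow_div_factorial_le_exp v hv 4
        rw [div_le_iff₀ (by positivity)] at h3
        norm_num [Nat.factorial] at h3
        linarith
      intro v
      have h4 := Real.exp_pos (-v)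
      have h5 := Real.exp_pos v
      rcases le_total 0 v with h | h
      · linarith [h2 v h]
      · have := h2 (-v) (by linarith)
        rw [Even.neg_pow (by decide)] at this
        linarith
    have h6 := h1 (t * u)
    have h7 : u ^ 4 = n ^ 2 * (t * u) ^ 4 := by
      calc u ^ 4 = (n * t ^ 2) ^ 2 * u ^ 4 := by rw [ht2]; ring
        _ = _ := by ring
    rw [h7, neg_mul]
    nlinarith [sq_nonneg n]
  calc ∫ ω, (∑ i, W i ω) ^ 4 ∂P
      ≤ ∫ ω, 24 * n ^ 2 * (Real.exp (t * ∑ i, W i ω) + Real.exp (-t * ∑ i, W i ω)) ∂P := by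
        refine integral_mono_of_nonneg (Filter.Eventually.of_forall fun ω => by positivity)
          (((hint t).add (hint (-t))).const_mul _) (Filter.Eventually.of_forall fun ω => hpt _)
    _ = 24 * n ^ 2 * (∫ ω, Real.exp (t * ∑ i, W i ω) ∂P +
          ∫ ω, Real.exp (-t * ∑ i, W i ω) ∂P) := by
        rw [integral_const_mul, integral_add (hint t) (hint (-t))]
    _ ≤ 24 * n ^ 2 * (2 + 2) := by
        have h2 : Real.exp (1 / 2) ≤ 2 := by
          rw [← Real.le_log_iff_exp_le (by norm_num)]
          linarith [Real.log_two_gt_d9]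
        have h3 := hmgf t
        have h4 := hmgf (-t)
        rw [neg_sq] at h4
        rw [ht2] at h3 h4
        gcongr <;> linarith
    _ = _ := by ring

/-- A variable whose fourth moment is of the order of its squared variance is large in mean. -/
lemma le_integral_abs {Ω : Type*} [MeasurableSpace Ω] {P : Measure Ω} {S : Ω → ℝ} {τ : ℝ}
    (hτ : 0 < τ) (h1 : Integrable S P) (h2 : Integrable (fun ω => S ω ^ 2) P)
    (h4 : Integrable (fun ω => S ω ^ 4) P) :
    (∫ ω, S ω ^ 2 ∂P) / τ - (∫ ω, S ω ^ 4 ∂P) / τ ^ 3 ≤ ∫ ω, |S ω| ∂P := by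
  rw [← integral_div, ← integral_div, ← integral_sub (h2.div_const _) (h4.div_const _)]
  refine integral_mono ((h2.div_const _).sub (h4.div_const _)) h1.abs fun ω => ?_
  dsimp only
  set u := |S ω| / τ with hu
  have hu0 : 0 ≤ u := by positivity
  have e1 : |S ω| = τ * u := by rw [hu]; field_simp
  have e2 : S ω ^ 2 / τ = τ * u ^ 2 := by rw [← sq_abs, e1]; field_simp
  have e4 : S ω ^ 4 / τ ^ 3 = τ * u ^ 4 := by
    rw [← Even.pow_abs (by decide : Even 4), e1]; field_simp
  rw [e1, e2, e4, ← mul_sub]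
  refine mul_le_mul_of_nonneg_left ?_ hτ.le
  rcases le_total u 1 with h | h
  · nlinarith [mul_nonneg hu0 hu0, pow_nonneg hu0 4]
  · have : u ^ 2 ≤ u ^ 4 := pow_le_pow_right₀ h (by norm_num)
    linarith

/-- Moments of the difference of the sums of a centred bounded function over the two clouds. -/
lemma moments_sum_sub_sum {d N : ℕ} (hN : 1 ≤ N) {Ω : Type*} [MeasurableSpace Ω]
    {P : Measure Ω} [IsProbabilityMeasure P] {X Y : Fin N → Ω → EuclideanSpace ℝ (Fin d)}
    (hX : ∀ n, Measurable (X n)) (hY : ∀ n, Measurable (Y n))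
    (hind : iIndepFun (Sum.elim X Y) P)
    (hXl : ∀ n, P.map (X n) = volume.restrict (box d 1))
    (hYl : ∀ n, P.map (Y n) = volume.restrict (box d 1))
    {g : EuclideanSpace ℝ (Fin d) → ℝ} (hg : Measurable g) (hb : ∀ x ∈ box d 1, |g x| ≤ 1)
    (h0 : ∫ x in box d 1, g x = 0) :
    ∫ ω, (∑ n, g (Y n ω) - ∑ n, g (X n ω)) ^ 2 ∂P = 2 * N * ∫ x in box d 1, g x ^ 2 ∧
      ∫ ω, (∑ n, g (Y n ω) - ∑ n, g (X n ω)) ^ 4 ∂P ≤ 384 * (N : ℝ) ^ 2 := by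
  set G : Fin N ⊕ Fin N → EuclideanSpace ℝ (Fin d) → ℝ :=
    Sum.elim (fun _ x => -g x) (fun _ x => g x) with hG
  set V : Fin N ⊕ Fin N → Ω → EuclideanSpace ℝ (Fin d) := Sum.elim X Y with hV
  have hVm : ∀ i, Measurable (V i) := by rintro (i | i); exacts [hX i, hY i]
  have hVl : ∀ i, P.map (V i) = volume.restrict (box d 1) := by
    rintro (i | i); exacts [hXl i, hYl i]
  have hGm : ∀ i, Measurable (G i) := by rintro (i | i); exacts [hg.neg, hg]
  set W : Fin N ⊕ Fin N → Ω → ℝ := fun i ω => G i (V i ω) with hW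
  have hWm : ∀ i, Measurable (W i) := fun i => (hGm i).comp (hVm i)
  have hWi : iIndepFun W P := hind.comp G hGm
  have hWb : ∀ i, ∀ᵐ ω ∂P, |W i ω| ≤ 1 := fun i => by
    filter_upwards [ae_mem_box (hVm i) (hVl i)] with ω h
    have h := hb _ h
    rcases i with i | i
    · simpa only [hW, hG, Sum.elim_inl, abs_neg] using h
    · simpa only [hW, hG, Sum.elim_inr] using h
  have hW0 : ∀ i, ∫ ω, W i ω ∂P = 0 := fun i => by
    rw [hW, integral_comp_uniform (hVm i) (hVl i) (hGm i)]
    rcases i with i | i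
    · simp only [hG, Sum.elim_inl, integral_neg, h0, neg_zero]
    · simp only [hG, Sum.elim_inr, h0]
  have hW2 : ∀ i, ∫ ω, W i ω ^ 2 ∂P = ∫ x in box d 1, g x ^ 2 := fun i => by
    have := integral_comp_uniform (hVm i) (hVl i) ((hGm i).pow_const 2)
    rw [hW, this]
    rcases i with i | i
    · simp only [hG, Sum.elim_inl, neg_sq]
    · simp only [hG, Sum.elim_inr]
  have hsum : ∀ ω, ∑ n, g (Y n ω) - ∑ n, g (X n ω) = ∑ i, W i ω := fun ω => by
    rw [Fintype.sum_sum_type]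
    simp only [hW, hG, hV, Sum.elim_inl, Sum.elim_inr, Finset.sum_neg_distrib]
    ring
  simp only [hsum]
  constructor
  · rw [integral_sq_sum_of_iIndepFun hWm hWi hWb hW0]
    simp only [hW2, Finset.sum_const, Finset.card_univ, Fintype.card_sum, Fintype.card_fin,
      nsmul_eq_mul, Nat.cast_add]
    ring
  · have : Nonempty (Fin N ⊕ Fin N) := ⟨Sum.inl ⟨0, hN⟩⟩
    refine (integral_pow_four_sum_le hWm hWi hWb hW0).trans (le_of_eq ?_)
    simp only [Fintype.card_sum, Fintype.card_fin, Nat.cast_add]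
    ring

/-! ### Lower bound in dimension one -/

/-- By the Cauchy–Schwarz inequality the cost is at least the squared displacement of the mean. -/
lemma lower_bound_dim_one {N : ℕ} (hN : 1 ≤ N) {Ω : Type*} [MeasurableSpace Ω]
    {P : Measure Ω} [IsProbabilityMeasure P] {X Y : Fin N → Ω → EuclideanSpace ℝ (Fin 1)}
    (hX : ∀ n, Measurable (X n)) (hY : ∀ n, Measurable (Y n))
    (hind : iIndepFun (Sum.elim X Y) P)
    (hXl : ∀ n, P.map (X n) = volume.restrict (box 1 1))
    (hYl : ∀ n, P.map (Y n) = volume.restrict (box 1 1)) :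
    1 / (6 * N) ≤ ∫ ω, matchingCost (fun n => X n ω) (fun n => Y n ω) ∂P := by
  have hN0 : (0 : ℝ) < N := by exact_mod_cast hN
  have hcell : ∀ h : EuclideanSpace ℝ (Fin 1) → ℝ,
      ∫ x in box 1 1, h x = ∫ x in cell (fun _ => 0) (fun _ => 1), h x := fun h => by
    rw [restrict_box_eq_restrict_cell]
  have hmean : ∫ x : EuclideanSpace ℝ (Fin 1) in box 1 1, (x 0 - 1 / 2) = 0 := by
    rw [hcell, setIntegral_cell_coord (fun _ => zero_le_one) (fun t => t - 1 / 2),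
      integral_Ico_eq_integral_Ioc, ← intervalIntegral.integral_of_le (by norm_num),
      intervalIntegral.integral_comp_sub_right (fun t => t), integral_id]
    norm_num
  have hvar : ∫ x : EuclideanSpace ℝ (Fin 1) in box 1 1, (x 0 - 1 / 2) ^ 2 = 1 / 12 := by
    rw [hcell, setIntegral_cell_sq fun _ => zero_le_one]
    norm_num
  have hb : ∀ x ∈ box 1 1, |(x : EuclideanSpace ℝ (Fin 1)) 0 - 1 / 2| ≤ 1 := fun x hx => by
    have h := hx 0
    rw [Set.mem_Icc] at h
    rw [abs_le]
    constructor <;> linarith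
  have hsq := (moments_sum_sub_sum hN hX hY hind hXl hYl (by fun_prop) hb hmean).1
  rw [hvar] at hsq
  have hpt : ∀ ω, (∑ n, (Y n ω 0 - 1 / 2) - ∑ n, (X n ω 0 - 1 / 2)) ^ 2 / (N : ℝ) ^ 2 ≤
      matchingCost (fun n => X n ω) (fun n => Y n ω) := fun ω => by
    obtain ⟨σ, hσ⟩ := exists_matchingCost_eq (fun n => X n ω) (fun n => Y n ω)
    have h1 : ∑ n, (Y n ω 0 - 1 / 2) - ∑ n, (X n ω 0 - 1 / 2) =
        ∑ n, (Y (σ n) ω 0 - X n ω 0) := by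
      rw [Finset.sum_sub_distrib (f := fun n => Y (σ n) ω 0), Equiv.sum_comp σ fun n => Y n ω 0,
        Finset.sum_sub_distrib, Finset.sum_sub_distrib]
      ring
    have h2 : (∑ n, (Y (σ n) ω 0 - X n ω 0)) ^ 2 ≤ N * ∑ n, ‖Y (σ n) ω - X n ω‖ ^ 2 := by
      have := sq_sum_le_card_mul_sum_sq (s := (Finset.univ : Finset (Fin N)))
        (f := fun n => Y (σ n) ω 0 - X n ω 0)
      simpa [EuclideanSpace.norm_sq_eq] using this
    rw [hσ, h1, div_le_iff₀ (by positivity)]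
    calc _ ≤ _ := h2
      _ = _ := by field_simp
  calc 1 / (6 * (N : ℝ)) =
        ∫ ω, (∑ n, (Y n ω 0 - 1 / 2) - ∑ n, (X n ω 0 - 1 / 2)) ^ 2 / (N : ℝ) ^ 2 ∂P := by
        rw [integral_div, hsq]
        field_simp
        norm_num
    _ ≤ _ := integral_mono_of_nonneg (Filter.Eventually.of_forall fun ω => by positivity)
        (integrable_matchingCost hX hY hXl hYl) (Filter.Eventually.of_forall hpt)

/-! ### Lower bound by nearest neighbours -/

lemma volume_ball_le {d : ℕ} (x : EuclideanSpace ℝ (Fin d)) {t : ℝ} (ht : 0 < t) :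
    volume (Metric.ball x t) ≤ ENNReal.ofReal ((2 * t) ^ d) := by
  have hsub : Metric.ball x t ⊆ (WithLp.ofLp : EuclideanSpace ℝ (Fin d) → Fin d → ℝ) ⁻¹'
      Metric.ball (WithLp.ofLp x) t := fun y hy => by
    rw [Set.mem_preimage, Metric.mem_ball, dist_pi_lt_iff ht]
    intro i
    rw [Metric.mem_ball, dist_eq_norm] at hy
    rw [dist_eq_norm]
    exact (PiLp.norm_apply_le (y - x) i).trans_lt hy
  refine (measure_mono hsub).trans ?_
  rw [(PiLp.volume_preserving_ofLp (Fin d)).measure_preimage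
    Metric.isOpen_ball.measurableSet.nullMeasurableSet, Real.volume_pi_ball _ ht, Fintype.card_fin]

lemma measure_norm_sub_lt_le {d : ℕ} {Ω : Type*} [MeasurableSpace Ω] {P : Measure Ω}
    [IsProbabilityMeasure P] {X Y : Ω → EuclideanSpace ℝ (Fin d)} (hX : Measurable X)
    (hY : Measurable Y) (hind : IndepFun X Y P) (hXl : P.map X = volume.restrict (box d 1))
    (hYl : P.map Y = volume.restrict (box d 1)) {t : ℝ} (ht : 0 < t) :
    P {ω | ‖Y ω - X ω‖ < t} ≤ ENNReal.ofReal ((2 * t) ^ d) := by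
  set A : Set (EuclideanSpace ℝ (Fin d) × EuclideanSpace ℝ (Fin d)) := {z | ‖z.2 - z.1‖ < t}
    with hA
  have hAm : MeasurableSet A :=
    measurableSet_lt (by fun_prop : Measurable fun z : EuclideanSpace ℝ (Fin d) ×
      EuclideanSpace ℝ (Fin d) => ‖z.2 - z.1‖) measurable_const
  have h1 : P {ω | ‖Y ω - X ω‖ < t} = P.map (fun ω => (X ω, Y ω)) A := by
    rw [Measure.map_apply (hX.prodMk hY) hAm]; rfl
  rw [h1, (indepFun_iff_map_prod_eq_prod_map_map hX.aemeasurable hY.aemeasurable).1 hind, hXl, hYl,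
    Measure.prod_apply hAm]
  calc _ ≤ ∫⁻ _x, ENNReal.ofReal ((2 * t) ^ d) ∂(volume.restrict (box d 1)) := by
        refine lintegral_mono fun x => ?_
        refine (Measure.restrict_apply_le _ _).trans ?_
        have : Prod.mk x ⁻¹' A = Metric.ball x t := by
          ext y; simp [hA, dist_eq_norm]
        rw [this]
        exact volume_ball_le x ht
    _ = _ := by rw [lintegral_const, measure_univ, mul_one]

/-- A union bound over the `N` points of the other cloud: at distance `ρ / 4` there is none with
probability at least `1/2`. -/
lemma lower_bound_nearest_neighbour {d N : ℕ} (hd : 0 < d) (hN : 1 ≤ N) {Ω : Type*}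
    [MeasurableSpace Ω] {P : Measure Ω} [IsProbabilityMeasure P]
    {X Y : Fin N → Ω → EuclideanSpace ℝ (Fin d)}
    (hX : ∀ n, Measurable (X n)) (hY : ∀ n, Measurable (Y n))
    (hind : iIndepFun (Sum.elim X Y) P)
    (hXl : ∀ n, P.map (X n) = volume.restrict (box d 1))
    (hYl : ∀ n, P.map (Y n) = volume.restrict (box d 1)) :
    microScale d 1 N ^ 2 / 32 ≤ ∫ ω, matchingCost (fun n => X n ω) (fun n => Y n ω) ∂P := by
  have hN0 : (0 : ℝ) < N := by exact_mod_cast hN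
  obtain ⟨-, -, hρd, hρ⟩ := microScale_one_bounds hd hN
  set ρ := microScale d 1 N
  set t := ρ / 4 with ht
  have ht0 : 0 < t := by positivity
  set B : Fin N → Set Ω := fun n => ⋃ m, {ω | ‖Y m ω - X n ω‖ < t} with hB
  have hBm : ∀ n, MeasurableSet (B n) := fun n => MeasurableSet.iUnion fun m =>
    measurableSet_lt ((hY m).sub (hX n)).norm measurable_const
  have hPB : ∀ n, P.real (B n) ≤ 1 / 2 := fun n => by
    have h1 : ∀ m, P.real {ω | ‖Y m ω - X n ω‖ < t} ≤ (2 * t) ^ d := fun m => by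
      have := measure_norm_sub_lt_le (hX n) (hY m)
        (hind.indepFun (i := Sum.inl n) (j := Sum.inr m) (by simp)) (hXl n) (hYl m) ht0
      exact ENNReal.toReal_le_of_le_ofReal (by positivity) this
    calc P.real (B n) ≤ ∑ m, P.real {ω | ‖Y m ω - X n ω‖ < t} := measureReal_iUnion_fintype_le _
      _ ≤ ∑ _m : Fin N, (2 * t) ^ d := Finset.sum_le_sum fun m _ => h1 m
      _ = N * ((1 / 2) ^ d * ρ ^ d) := by
        rw [Finset.sum_const, Finset.card_univ, Fintype.card_fin, nsmul_eq_mul, ← mul_pow, ht]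
        congr 2; ring
      _ = (1 / 2) ^ d := by rw [hρd]; field_simp
      _ ≤ 1 / 2 := pow_le_of_le_one (by norm_num) (by norm_num) hd.ne'
  have hpt : ∀ ω, 1 / (N : ℝ) * ∑ n, (B n)ᶜ.indicator (fun _ => t ^ 2) ω ≤
      matchingCost (fun n => X n ω) (fun n => Y n ω) := fun ω => by
    obtain ⟨σ, hσ⟩ := exists_matchingCost_eq (fun n => X n ω) (fun n => Y n ω)
    rw [hσ]
    refine mul_le_mul_of_nonneg_left (Finset.sum_le_sum fun n _ => ?_) (by positivity)
    refine Set.indicator_apply_le' (fun h => ?_) fun _ => by positivity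
    have : t ≤ ‖Y (σ n) ω - X n ω‖ := by
      by_contra! h'
      exact h (Set.mem_iUnion.2 ⟨σ n, h'⟩)
    exact pow_le_pow_left₀ ht0.le this 2
  have hI : ∀ n, Integrable ((B n)ᶜ.indicator fun _ => t ^ 2) P := fun n =>
    (integrable_const _).indicator (hBm n).compl
  calc ρ ^ 2 / 32 = 1 / (N : ℝ) * ∑ _n : Fin N, (1 / 2 * t ^ 2) := by
        rw [Finset.sum_const, Finset.card_univ, Fintype.card_fin, nsmul_eq_mul, ht]
        field_simp
        norm_num
    _ ≤ 1 / (N : ℝ) * ∑ n, P.real (B n)ᶜ * t ^ 2 := by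
        gcongr with n
        rw [probReal_compl_eq_one_sub (hBm n)]
        linarith [hPB n]
    _ = ∫ ω, 1 / (N : ℝ) * ∑ n, (B n)ᶜ.indicator (fun _ => t ^ 2) ω ∂P := by
        rw [integral_const_mul, integral_finsetSum _ fun n _ => hI n]
        simp only [integral_indicator_const _ (hBm _).compl, smul_eq_mul]
    _ ≤ _ := integral_mono ((integrable_finsetSum _ fun n _ => hI n).const_mul _)
        (integrable_matchingCost hX hY hXl hYl) hpt

/-! ### Plane waves on the unit square -/

/-- The phase `2π (u x₀ + v x₁)`. -/
noncomputable def phase (u v : ℝ) (x : EuclideanSpace ℝ (Fin 2)) : ℝ :=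
  2 * Real.pi * (u * x 0 + v * x 1)

lemma measurable_phase (u v : ℝ) : Measurable (phase u v) := by
  unfold phase; fun_prop

lemma integral_cos_two_pi_int_mul {a : ℤ} (ha : a ≠ 0) :
    ∫ t in Set.Icc (0 : ℝ) 1, Real.cos (2 * Real.pi * (a * t)) = 0 := by
  have ha' : (2 * Real.pi * a : ℝ) ≠ 0 := by
    have : (a : ℝ) ≠ 0 := by exact_mod_cast ha
    positivity
  rw [integral_Icc_eq_integral_Ioc, ← intervalIntegral.integral_of_le zero_le_one]
  simp only [← mul_assoc]
  rw [intervalIntegral.integral_comp_mul_left (fun t => Real.cos t) ha', integral_cos]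
  have : Real.sin (2 * Real.pi * a) = 0 := by
    rw [mul_comm]
    have := Real.sin_int_mul_pi (a * 2)
    push_cast at this
    rwa [mul_assoc] at this
  simp [this]

lemma integral_sin_two_pi_int_mul (a : ℤ) :
    ∫ t in Set.Icc (0 : ℝ) 1, Real.sin (2 * Real.pi * (a * t)) = 0 := by
  rcases eq_or_ne a 0 with rfl | ha
  · simp
  have ha' : (2 * Real.pi * a : ℝ) ≠ 0 := by
    have : (a : ℝ) ≠ 0 := by exact_mod_cast ha
    positivity
  rw [integral_Icc_eq_integral_Ioc, ← intervalIntegral.integral_of_le zero_le_one]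
  simp only [← mul_assoc]
  rw [intervalIntegral.integral_comp_mul_left (fun t => Real.sin t) ha', integral_sin]
  have : Real.cos (2 * Real.pi * a) = 1 := by
    rw [mul_comm, Real.cos_int_mul_two_pi]
  simp [this]

lemma integrableOn_box_of_bounded {f : EuclideanSpace ℝ (Fin 2) → ℝ} (hf : Measurable f) {C : ℝ}
    (h : ∀ x, |f x| ≤ C) : IntegrableOn f (box 2 1) :=
  Integrable.of_bound hf.aestronglyMeasurable C (Filter.Eventually.of_forall h)

lemma integral_cos_phase {a b : ℤ} (h : a ≠ 0 ∨ b ≠ 0) :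
    ∫ x in box 2 1, Real.cos (phase a b x) = 0 := by
  have hp : ∀ f g : ℝ → ℝ, ∫ x : EuclideanSpace ℝ (Fin 2) in box 2 1, f (x 0) * g (x 1) =
      (∫ t in Set.Icc (0 : ℝ) 1, f t) * ∫ t in Set.Icc (0 : ℝ) 1, g t := fun f g => by
    have := setIntegral_preimage_pi (fun _ : Fin 2 => Set.Icc (0 : ℝ) 1) ![f, g]
    rw [← box_eq_preimage] at this
    simpa [Fin.prod_univ_two] using this
  have e : ∀ x : EuclideanSpace ℝ (Fin 2), Real.cos (phase a b x) =
      Real.cos (2 * Real.pi * (a * x 0)) * Real.cos (2 * Real.pi * (b * x 1)) -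
      Real.sin (2 * Real.pi * (a * x 0)) * Real.sin (2 * Real.pi * (b * x 1)) := fun x => by
    rw [phase, mul_add, Real.cos_add]
  simp only [e]
  rw [integral_sub
    (integrableOn_box_of_bounded (C := 1) (by fun_prop) fun x => by
      rw [abs_mul]
      exact mul_le_one₀ (Real.abs_cos_le_one _) (abs_nonneg _) (Real.abs_cos_le_one _))
    (integrableOn_box_of_bounded (C := 1) (by fun_prop) fun x => by
      rw [abs_mul]
      exact mul_le_one₀ (Real.abs_sin_le_one _) (abs_nonneg _) (Real.abs_sin_le_one _)),
    hp (fun t => Real.cos (2 * Real.pi * (a * t))) fun t => Real.cos (2 * Real.pi * (b * t)),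
    hp (fun t => Real.sin (2 * Real.pi * (a * t))) fun t => Real.sin (2 * Real.pi * (b * t)),
    integral_sin_two_pi_int_mul]
  rcases h with h | h <;> simp [integral_cos_two_pi_int_mul h]

lemma integral_cos_phase_sq {a b : ℕ} (ha : a ≠ 0) :
    ∫ x in box 2 1, Real.cos (phase a b x) ^ 2 = 1 / 2 := by
  have e : ∀ x, Real.cos (phase a b x) ^ 2 =
      1 / 2 + 1 / 2 * Real.cos (phase ((2 * a : ℤ) : ℝ) ((2 * b : ℤ) : ℝ) x) := fun x => by
    rw [Real.cos_sq]
    have : 2 * phase a b x = phase ((2 * a : ℤ) : ℝ) ((2 * b : ℤ) : ℝ) x := by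
      simp only [phase]; push_cast; ring
    rw [this]; ring
  simp only [e]
  rw [integral_add (integrable_const _)
    ((integrableOn_box_of_bounded (C := 1) (measurable_phase _ _).cos
      fun x => Real.abs_cos_le_one _).const_mul _), integral_const_mul,
    integral_cos_phase (Or.inl (by omega))]
  simp

lemma integral_sin_phase_mul {a b a' b' : ℕ} (ha : a ≠ 0) :
    ∫ x in box 2 1, Real.sin (phase a b x) * Real.sin (phase a' b' x) =
      if (a, b) = (a', b') then 1 / 2 else 0 := by
  have e : ∀ x, Real.sin (phase a b x) * Real.sin (phase a' b' x) =
      1 / 2 * Real.cos (phase ((a - a' : ℤ) : ℝ) ((b - b' : ℤ) : ℝ) x) -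
      1 / 2 * Real.cos (phase ((a + a' : ℤ) : ℝ) ((b + b' : ℤ) : ℝ) x) := fun x => by
    have h1 : phase ((a - a' : ℤ) : ℝ) ((b - b' : ℤ) : ℝ) x = phase a b x - phase a' b' x := by
      simp only [phase]; push_cast; ring
    have h2 : phase ((a + a' : ℤ) : ℝ) ((b + b' : ℤ) : ℝ) x = phase a b x + phase a' b' x := by
      simp only [phase]; push_cast; ring
    rw [h1, h2, Real.cos_sub, Real.cos_add]
    ring
  have hI : ∀ u v : ℝ, Integrable (fun x => 1 / 2 * Real.cos (phase u v x))
      (volume.restrict (box 2 1)) := fun u v =>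
    (integrableOn_box_of_bounded (C := 1) (measurable_phase _ _).cos
      fun x => Real.abs_cos_le_one _).const_mul _
  simp only [e]
  rw [integral_sub (hI _ _) (hI _ _), integral_const_mul, integral_const_mul,
    integral_cos_phase (Or.inl (by omega : (a + a' : ℤ) ≠ 0))]
  split_ifs with h
  · obtain ⟨rfl, rfl⟩ := Prod.mk.inj h
    simp [phase]
  · rw [integral_cos_phase]
    · simp
    · by_contra! h'
      exact h (Prod.ext (by simp only; omega) (by simp only; omega))

/-! ### Test function in dimension two -/

lemma abs_cos_sub_cos_add_le (u h : ℝ) :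
    |Real.cos (u + h) - Real.cos u + h * Real.sin u| ≤ 3 * h ^ 2 := by
  have h1 : |h - Real.sin h| ≤ 2 * h ^ 2 := by
    have key : ∀ v : ℝ, 0 ≤ v → |v - Real.sin v| ≤ 2 * v ^ 2 := fun v hv => by
      rw [abs_of_nonneg (by linarith [Real.sin_le hv])]
      rcases le_or_gt v 1 with h | h
      · rcases hv.eq_or_lt with rfl | h0
        · simp
        · have := Real.sin_gt_sub_cube h0
          nlinarith [mul_nonneg hv hv]
      · nlinarith [Real.neg_one_le_sin v]
    rcases le_total 0 h with h0 | h0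
    · exact key h h0
    · have := key (-h) (by linarith)
      rw [Real.sin_neg, neg_sq, ← abs_neg] at this
      convert this using 2
      ring
  have h2 : |Real.cos h - 1| ≤ h ^ 2 / 2 := by
    rw [abs_le]
    constructor
    · linarith [Real.one_sub_sq_div_two_le_cos (x := h)]
    · nlinarith [Real.cos_le_one h]
  have e : Real.cos (u + h) - Real.cos u + h * Real.sin u =
      Real.cos u * (Real.cos h - 1) + Real.sin u * (h - Real.sin h) := by
    rw [Real.cos_add]; ring
  rw [e]
  calc _ ≤ |Real.cos u * (Real.cos h - 1)| + |Real.sin u * (h - Real.sin h)| := abs_add_le _ _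
    _ ≤ 1 * (h ^ 2 / 2) + 1 * (2 * h ^ 2) := by
        rw [abs_mul, abs_mul]
        gcongr
        · exact Real.abs_cos_le_one u
        · exact Real.abs_sin_le_one u
    _ ≤ _ := by nlinarith [sq_nonneg h]

/-- The frequencies in use: pairs of integers between `1` and `M`. -/
def freqs (M : ℕ) : Finset (ℕ × ℕ) := Finset.Icc 1 M ×ˢ Finset.Icc 1 M

/-- The inverse squared modulus of a frequency. -/
noncomputable def freqWeight (ξ : ℕ × ℕ) : ℝ := ((ξ.1 : ℝ) ^ 2 + (ξ.2 : ℝ) ^ 2)⁻¹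

/-- The centred empirical correlation of two sine waves over the cloud `x`. -/
noncomputable def sineCorrelation {N : ℕ} (x : Fin N → EuclideanSpace ℝ (Fin 2))
    (ξ η : ℕ × ℕ) : ℝ :=
  ∑ n, (Real.sin (phase ξ.1 ξ.2 (x n)) * Real.sin (phase η.1 η.2 (x n)) -
    if ξ = η then 1 / 2 else 0)

lemma one_le_of_mem_freqs {M : ℕ} {ξ : ℕ × ℕ} (h : ξ ∈ freqs M) :
    (1 : ℝ) ≤ ξ.1 ∧ (1 : ℝ) ≤ ξ.2 := by
  rw [freqs, Finset.mem_product, Finset.mem_Icc, Finset.mem_Icc] at h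
  exact ⟨by exact_mod_cast h.1.1, by exact_mod_cast h.2.1⟩

/-- The energy of the test function with signs `s` over the cloud `x`. Under the Lebesgue
measure its waves are orthogonal; `sineCorrelation` measures the failure of this for the cloud. -/
lemma sum_gradient_sq_le {M N : ℕ} (x : Fin N → EuclideanSpace ℝ (Fin 2)) {s : ℕ × ℕ → ℝ}
    (hs : ∀ ξ, |s ξ| = 1) :
    ∑ n, ((∑ ξ ∈ freqs M, s ξ * freqWeight ξ * ξ.1 * Real.sin (phase ξ.1 ξ.2 (x n))) ^ 2 +
      (∑ ξ ∈ freqs M, s ξ * freqWeight ξ * ξ.2 * Real.sin (phase ξ.1 ξ.2 (x n))) ^ 2) ≤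
    N / 2 * ∑ ξ ∈ freqs M, freqWeight ξ +
      ∑ ξ ∈ freqs M, ∑ η ∈ freqs M, |sineCorrelation x ξ η| := by
  set c : ℕ × ℕ → ℕ × ℕ → ℝ := fun ξ η =>
    s ξ * s η * (freqWeight ξ * freqWeight η * (ξ.1 * η.1 + ξ.2 * η.2)) with hc
  have e1 : ∀ n, (∑ ξ ∈ freqs M, s ξ * freqWeight ξ * ξ.1 * Real.sin (phase ξ.1 ξ.2 (x n))) ^ 2 +
      (∑ ξ ∈ freqs M, s ξ * freqWeight ξ * ξ.2 * Real.sin (phase ξ.1 ξ.2 (x n))) ^ 2 =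
      ∑ ξ ∈ freqs M, ∑ η ∈ freqs M, c ξ η *
        (Real.sin (phase ξ.1 ξ.2 (x n)) * Real.sin (phase η.1 η.2 (x n))) := fun n => by
    rw [sq, sq, Finset.sum_mul_sum, Finset.sum_mul_sum, ← Finset.sum_add_distrib]
    refine Finset.sum_congr rfl fun ξ _ => ?_
    rw [← Finset.sum_add_distrib]
    refine Finset.sum_congr rfl fun η _ => ?_
    simp only [hc]
    ring
  have e2 : ∀ ξ η, ∑ n, c ξ η *
      (Real.sin (phase ξ.1 ξ.2 (x n)) * Real.sin (phase η.1 η.2 (x n))) =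
      c ξ η * sineCorrelation x ξ η + if ξ = η then N / 2 * c ξ η else 0 := fun ξ η => by
    rw [← Finset.mul_sum, sineCorrelation, Finset.sum_sub_distrib, Finset.sum_const,
      Finset.card_univ, Fintype.card_fin, nsmul_eq_mul]
    split_ifs <;> ring
  rw [Finset.sum_congr rfl fun n _ => e1 n, Finset.sum_comm,
    Finset.sum_congr rfl fun ξ _ => Finset.sum_comm]
  simp only [e2]
  simp only [Finset.sum_add_distrib]
  rw [add_comm]
  refine add_le_add ?_ ?_
  · rw [Finset.mul_sum]
    refine Finset.sum_le_sum fun ξ hξ => ?_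
    rw [Finset.sum_ite_eq, if_pos hξ]
    refine mul_le_mul_of_nonneg_left (le_of_eq ?_) (by positivity)
    obtain ⟨h1, h2⟩ := one_le_of_mem_freqs hξ
    have h3 : s ξ * s ξ = 1 := by rw [← abs_mul_abs_self, hs, one_mul]
    have h4 : freqWeight ξ * (ξ.1 * ξ.1 + ξ.2 * ξ.2) = 1 := by
      rw [freqWeight, ← sq, ← sq]
      exact inv_mul_cancel₀ (by positivity)
    simp only [hc]
    rw [h3, mul_assoc, h4]
    ring
  · refine Finset.sum_le_sum fun ξ hξ => Finset.sum_le_sum fun η hη => ?_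
    obtain ⟨h1, h2⟩ := one_le_of_mem_freqs hξ
    obtain ⟨h3, h4⟩ := one_le_of_mem_freqs hη
    refine (le_abs_self _).trans ?_
    rw [abs_mul]
    refine mul_le_of_le_one_left (abs_nonneg _) ?_
    simp only [hc]
    rw [abs_mul, abs_mul, hs, hs, one_mul, one_mul, abs_of_nonneg (by unfold freqWeight; positivity),
      freqWeight, freqWeight, ← mul_inv, inv_mul_le_iff₀ (by positivity), mul_one]
    have h5 : (ξ.1 : ℝ) * η.1 ≤ ξ.1 ^ 2 * η.1 ^ 2 := by
      rw [← mul_pow]; exact le_self_pow₀ (by nlinarith) (by norm_num)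
    have h6 : (ξ.2 : ℝ) * η.2 ≤ ξ.2 ^ 2 * η.2 ^ 2 := by
      rw [← mul_pow]; exact le_self_pow₀ (by nlinarith) (by norm_num)
    have h7 : (0 : ℝ) ≤ ξ.1 ^ 2 * η.2 ^ 2 + ξ.2 ^ 2 * η.1 ^ 2 := by positivity
    linarith

/-- Duality: the cost of a matching is bounded below by the increments of the test function
`∑ ± |ξ|⁻² cos (2π ξ·x)`, the signs being chosen so that all frequencies contribute positively. -/
lemma sum_abs_wave_le {M N : ℕ} (hN : 1 ≤ N) (x y : Fin N → EuclideanSpace ℝ (Fin 2)) {t : ℝ}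
    (ht : 0 < t) :
    ∑ ξ ∈ freqs M, freqWeight ξ *
      |∑ n, Real.cos (phase ξ.1 ξ.2 (y n)) - ∑ n, Real.cos (phase ξ.1 ξ.2 (x n))| ≤
    2 * Real.pi ^ 2 * t * (N / 2 * ∑ ξ ∈ freqs M, freqWeight ξ +
      ∑ ξ ∈ freqs M, ∑ η ∈ freqs M, |sineCorrelation x ξ η|) +
    (1 / (2 * t) + 12 * Real.pi ^ 2 * M ^ 2) * (N * matchingCost x y) := by
  have hN0 : (0 : ℝ) < N := by exact_mod_cast hN
  obtain ⟨σ, hσ⟩ := exists_matchingCost_eq x y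
  set Z : ℕ × ℕ → ℝ := fun ξ =>
    ∑ n, Real.cos (phase ξ.1 ξ.2 (y n)) - ∑ n, Real.cos (phase ξ.1 ξ.2 (x n)) with hZ
  set s : ℕ × ℕ → ℝ := fun ξ => if 0 ≤ Z ξ then 1 else -1 with hs
  have hs1 : ∀ ξ, |s ξ| = 1 := fun ξ => by
    simp only [hs]; split_ifs <;> simp
  have hsZ : ∀ ξ, |Z ξ| = s ξ * Z ξ := fun ξ => by
    simp only [hs]
    split_ifs with h
    · rw [abs_of_nonneg h, one_mul]
    · rw [abs_of_neg (not_le.1 h), neg_one_mul]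
  have hZσ : ∀ ξ, Z ξ = ∑ n, (Real.cos (phase ξ.1 ξ.2 (y (σ n))) -
      Real.cos (phase ξ.1 ξ.2 (x n))) := fun ξ => by
    rw [Finset.sum_sub_distrib, Equiv.sum_comp σ fun n => Real.cos (phase ξ.1 ξ.2 (y n))]
  set G₀ : Fin N → ℝ := fun n =>
    ∑ ξ ∈ freqs M, s ξ * freqWeight ξ * ξ.1 * Real.sin (phase ξ.1 ξ.2 (x n)) with hG₀
  set G₁ : Fin N → ℝ := fun n =>
    ∑ ξ ∈ freqs M, s ξ * freqWeight ξ * ξ.2 * Real.sin (phase ξ.1 ξ.2 (x n)) with hG₁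
  have hnorm : ∀ n, ‖y (σ n) - x n‖ ^ 2 = (y (σ n) 0 - x n 0) ^ 2 + (y (σ n) 1 - x n 1) ^ 2 :=
    fun n => by simp [EuclideanSpace.norm_sq_eq, Fin.sum_univ_two]
  -- Second-order Taylor expansion of one wave; the weight cancels the squared frequency.
  have hwave : ∀ n, ∀ ξ ∈ freqs M, freqWeight ξ * (s ξ * (Real.cos (phase ξ.1 ξ.2 (y (σ n))) -
      Real.cos (phase ξ.1 ξ.2 (x n)))) ≤
      -(2 * Real.pi * (y (σ n) 0 - x n 0)) *
        (s ξ * freqWeight ξ * ξ.1 * Real.sin (phase ξ.1 ξ.2 (x n))) -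
      2 * Real.pi * (y (σ n) 1 - x n 1) *
        (s ξ * freqWeight ξ * ξ.2 * Real.sin (phase ξ.1 ξ.2 (x n))) +
      12 * Real.pi ^ 2 * ‖y (σ n) - x n‖ ^ 2 := fun n ξ hξ => by
    obtain ⟨h1, h2⟩ := one_le_of_mem_freqs hξ
    set a := y (σ n) 0 - x n 0
    set b := y (σ n) 1 - x n 1
    have hw : 0 < freqWeight ξ := by unfold freqWeight; positivity
    have hw1 : freqWeight ξ * ((ξ.1 : ℝ) ^ 2 + (ξ.2 : ℝ) ^ 2) = 1 :=
      inv_mul_cancel₀ (by positivity)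
    have hph : phase ξ.1 ξ.2 (y (σ n)) =
        phase ξ.1 ξ.2 (x n) + 2 * Real.pi * (ξ.1 * a + ξ.2 * b) := by
      simp only [phase, a, b]; ring
    have h3 := abs_cos_sub_cos_add_le (phase ξ.1 ξ.2 (x n)) (2 * Real.pi * (ξ.1 * a + ξ.2 * b))
    rw [← hph] at h3
    set D := Real.cos (phase ξ.1 ξ.2 (y (σ n))) - Real.cos (phase ξ.1 ξ.2 (x n)) +
      2 * Real.pi * (ξ.1 * a + ξ.2 * b) * Real.sin (phase ξ.1 ξ.2 (x n)) with hD
    have h4 : s ξ * D ≤ 3 * (2 * Real.pi * (ξ.1 * a + ξ.2 * b)) ^ 2 := by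
      refine (le_abs_self _).trans ?_
      rwa [abs_mul, hs1, one_mul]
    have h5 : (ξ.1 * a + ξ.2 * b : ℝ) ^ 2 ≤ ((ξ.1 : ℝ) ^ 2 + (ξ.2 : ℝ) ^ 2) * (a ^ 2 + b ^ 2) := by
      nlinarith [sq_nonneg (ξ.1 * b - ξ.2 * a : ℝ)]
    have h6 : freqWeight ξ * (s ξ * D) ≤ 12 * Real.pi ^ 2 * (a ^ 2 + b ^ 2) := by
      calc freqWeight ξ * (s ξ * D)
          ≤ freqWeight ξ * (12 * Real.pi ^ 2 *
            (((ξ.1 : ℝ) ^ 2 + (ξ.2 : ℝ) ^ 2) * (a ^ 2 + b ^ 2))) := by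
            refine mul_le_mul_of_nonneg_left (h4.trans ?_) hw.le
            have := mul_le_mul_of_nonneg_left h5 (by positivity : 0 ≤ 12 * Real.pi ^ 2)
            calc _ = 12 * Real.pi ^ 2 * (ξ.1 * a + ξ.2 * b : ℝ) ^ 2 := by ring
              _ ≤ _ := this
        _ = (freqWeight ξ * ((ξ.1 : ℝ) ^ 2 + (ξ.2 : ℝ) ^ 2)) *
            (12 * Real.pi ^ 2 * (a ^ 2 + b ^ 2)) := by ring
        _ = _ := by rw [hw1, one_mul]
    rw [hnorm]
    refine le_trans (le_of_eq ?_) (add_le_add_right h6 _)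
    rw [hD]
    ring
  have hpoint : ∀ n, ∑ ξ ∈ freqs M, freqWeight ξ * (s ξ * (Real.cos (phase ξ.1 ξ.2 (y (σ n))) -
      Real.cos (phase ξ.1 ξ.2 (x n)))) ≤ 2 * Real.pi ^ 2 * t * (G₀ n ^ 2 + G₁ n ^ 2) +
      (1 / (2 * t) + 12 * Real.pi ^ 2 * M ^ 2) * ‖y (σ n) - x n‖ ^ 2 := fun n => by
    refine (Finset.sum_le_sum (hwave n)).trans ?_
    rw [Finset.sum_add_distrib, Finset.sum_sub_distrib, ← Finset.mul_sum, ← Finset.mul_sum]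
    change -(2 * Real.pi * (y (σ n) 0 - x n 0)) * G₀ n - 2 * Real.pi * (y (σ n) 1 - x n 1) * G₁ n +
      _ ≤ _
    have hcard : ((freqs M).card : ℝ) = M ^ 2 := by simp [freqs, sq]
    rw [Finset.sum_const, nsmul_eq_mul, hcard]
    -- Young's inequality for the first-order term.
    have hy : ∀ a g : ℝ, -(2 * Real.pi * a) * g ≤
        2 * Real.pi ^ 2 * t * g ^ 2 + 1 / (2 * t) * a ^ 2 := fun a g => by
      have h0 : 0 ≤ 1 / (2 * t) * (a + 2 * Real.pi * t * g) ^ 2 := by positivity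
      have h1 : 1 / (2 * t) * (a + 2 * Real.pi * t * g) ^ 2 =
          1 / (2 * t) * a ^ 2 + 2 * Real.pi * a * g + 2 * Real.pi ^ 2 * t * g ^ 2 := by
        field_simp; ring
      linarith
    have h0 := hy (y (σ n) 0 - x n 0) (G₀ n)
    have h1 := hy (y (σ n) 1 - x n 1) (G₁ n)
    have h2 := hnorm n
    rw [add_mul, h2]
    linarith
  calc _ = ∑ n, ∑ ξ ∈ freqs M, freqWeight ξ * (s ξ * (Real.cos (phase ξ.1 ξ.2 (y (σ n))) -
        Real.cos (phase ξ.1 ξ.2 (x n)))) := by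
        rw [Finset.sum_comm]
        refine Finset.sum_congr rfl fun ξ _ => ?_
        change freqWeight ξ * |Z ξ| = _
        rw [hsZ, hZσ, Finset.mul_sum, Finset.mul_sum]
    _ ≤ ∑ n, (2 * Real.pi ^ 2 * t * (G₀ n ^ 2 + G₁ n ^ 2) +
        (1 / (2 * t) + 12 * Real.pi ^ 2 * M ^ 2) * ‖y (σ n) - x n‖ ^ 2) :=
        Finset.sum_le_sum fun n _ => hpoint n
    _ = 2 * Real.pi ^ 2 * t * ∑ n, (G₀ n ^ 2 + G₁ n ^ 2) +
        (1 / (2 * t) + 12 * Real.pi ^ 2 * M ^ 2) * (N * matchingCost x y) := by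
        rw [Finset.sum_add_distrib, ← Finset.mul_sum, ← Finset.mul_sum, hσ]
        congr 2
        field_simp
    _ ≤ _ := by
        gcongr
        exact sum_gradient_sq_le x hs1

/-! ### Lower bound in dimension two -/

lemma sqrt_le_integral_abs_wave {N : ℕ} (hN : 1 ≤ N) {Ω : Type*} [MeasurableSpace Ω]
    {P : Measure Ω} [IsProbabilityMeasure P] {X Y : Fin N → Ω → EuclideanSpace ℝ (Fin 2)}
    (hX : ∀ n, Measurable (X n)) (hY : ∀ n, Measurable (Y n))
    (hind : iIndepFun (Sum.elim X Y) P)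
    (hXl : ∀ n, P.map (X n) = volume.restrict (box 2 1))
    (hYl : ∀ n, P.map (Y n) = volume.restrict (box 2 1)) {a b : ℕ} (ha : a ≠ 0) :
    √(N : ℝ) / 60 ≤ ∫ ω, |∑ n, Real.cos (phase a b (Y n ω)) -
      ∑ n, Real.cos (phase a b (X n ω))| ∂P := by
  have hN0 : (0 : ℝ) < N := by exact_mod_cast hN
  have hm : Measurable fun x => Real.cos (phase a b x) := (measurable_phase _ _).cos
  have h0 : ∫ x in box 2 1, Real.cos (phase a b x) = 0 := by
    have := integral_cos_phase (a := a) (b := b) (Or.inl (by exact_mod_cast ha))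
    simpa only [Int.cast_natCast] using this
  obtain ⟨h2, h4⟩ := moments_sum_sub_sum hN hX hY hind hXl hYl hm
    (fun x _ => Real.abs_cos_le_one _) h0
  rw [integral_cos_phase_sq ha] at h2
  set S : Ω → ℝ := fun ω => ∑ n, Real.cos (phase a b (Y n ω)) -
    ∑ n, Real.cos (phase a b (X n ω)) with hS
  have hSm : Measurable S := (Finset.measurable_sum _ fun n _ => hm.comp (hY n)).sub
    (Finset.measurable_sum _ fun n _ => hm.comp (hX n))
  have hSb : ∀ ω, |S ω| ≤ 2 * N := fun ω => by
    have hb : ∀ z : Fin N → EuclideanSpace ℝ (Fin 2), |∑ n, Real.cos (phase a b (z n))| ≤ N :=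
      fun z => by
        refine (Finset.abs_sum_le_sum_abs _ _).trans ?_
        refine (Finset.sum_le_sum fun n _ => Real.abs_cos_le_one _).trans ?_
        simp
    refine (abs_sub _ _).trans ?_
    linarith [hb fun n => Y n ω, hb fun n => X n ω]
  have hint : ∀ k : ℕ, Integrable (fun ω => S ω ^ k) P := fun k =>
    Integrable.of_bound (hSm.pow_const k).aestronglyMeasurable ((2 * N) ^ k)
      (Filter.Eventually.of_forall fun ω => by
        rw [norm_pow, Real.norm_eq_abs]
        exact pow_le_pow_left₀ (abs_nonneg _) (hSb ω) k)
  have hr : 0 < √(N : ℝ) := Real.sqrt_pos.2 hN0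
  have hr2 : √(N : ℝ) ^ 2 = N := Real.sq_sqrt hN0.le
  have key := le_integral_abs (P := P) (S := S) (τ := 30 * √(N : ℝ)) (by positivity)
    (by simpa using hint 1) (hint 2) (hint 4)
  refine le_trans ?_ key
  set r := √(N : ℝ)
  have h2' : ∫ ω, S ω ^ 2 ∂P = r ^ 2 := by rw [hr2]; exact h2.trans (by ring)
  have h4' : ∫ ω, S ω ^ 4 ∂P ≤ 384 * r ^ 4 := by
    have : r ^ 4 = (N : ℝ) ^ 2 := by rw [← hr2]; ring
    rw [this]; exact h4
  rw [h2']
  have h5 : (∫ ω, S ω ^ 4 ∂P) / (30 * r) ^ 3 ≤ 384 * r ^ 4 / (30 * r) ^ 3 := by gcongr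
  have h6 : 384 * r ^ 4 / (30 * r) ^ 3 = 384 / 27000 * r := by field_simp; norm_num
  have h7 : r ^ 2 / (30 * r) = r / 30 := by field_simp
  rw [h7]
  linarith

lemma abs_sineCorrelation_term_le (ξ η : ℕ × ℕ) (x : EuclideanSpace ℝ (Fin 2)) :
    |Real.sin (phase ξ.1 ξ.2 x) * Real.sin (phase η.1 η.2 x) - if ξ = η then 1 / 2 else 0| ≤ 1 := by
  split_ifs with h
  · subst h
    have h1 := Real.sin_sq_add_cos_sq (phase ξ.1 ξ.2 x)
    rw [abs_le]
    constructor <;>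
      nlinarith [sq_nonneg (Real.sin (phase ξ.1 ξ.2 x)), sq_nonneg (Real.cos (phase ξ.1 ξ.2 x))]
  · rw [sub_zero, abs_mul]
    exact mul_le_one₀ (Real.abs_sin_le_one _) (abs_nonneg _) (Real.abs_sin_le_one _)

lemma measurable_sineCorrelation_term (ξ η : ℕ × ℕ) :
    Measurable fun x => Real.sin (phase ξ.1 ξ.2 x) * Real.sin (phase η.1 η.2 x) -
      if ξ = η then (1 / 2 : ℝ) else 0 :=
  ((measurable_phase _ _).sin.mul (measurable_phase _ _).sin).sub_const _

lemma integrable_sineCorrelation {N : ℕ} {Ω : Type*} [MeasurableSpace Ω]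
    {P : Measure Ω} [IsFiniteMeasure P] {X : Fin N → Ω → EuclideanSpace ℝ (Fin 2)}
    (hX : ∀ n, Measurable (X n)) (ξ η : ℕ × ℕ) :
    Integrable (fun ω => sineCorrelation (fun n => X n ω) ξ η) P :=
  integrable_finsetSum _ fun n _ => Integrable.of_bound
    ((measurable_sineCorrelation_term ξ η).comp (hX n)).aestronglyMeasurable 1
    (Filter.Eventually.of_forall fun _ => abs_sineCorrelation_term_le ξ η _)

/-- The correlation is a sum of `N` independent centred terms bounded by `1`. -/
lemma integral_abs_sineCorrelation_le {N : ℕ} (hN : 1 ≤ N) {Ω : Type*} [MeasurableSpace Ω]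
    {P : Measure Ω} [IsProbabilityMeasure P] {X : Fin N → Ω → EuclideanSpace ℝ (Fin 2)}
    (hX : ∀ n, Measurable (X n)) (hind : iIndepFun X P)
    (hXl : ∀ n, P.map (X n) = volume.restrict (box 2 1)) {ξ : ℕ × ℕ} (hξ : ξ.1 ≠ 0)
    (η : ℕ × ℕ) :
    ∫ ω, |sineCorrelation (fun n => X n ω) ξ η| ∂P ≤ √(N : ℝ) := by
  have hN0 : (0 : ℝ) < N := by exact_mod_cast hN
  set g : EuclideanSpace ℝ (Fin 2) → ℝ := fun x =>
    Real.sin (phase ξ.1 ξ.2 x) * Real.sin (phase η.1 η.2 x) - if ξ = η then 1 / 2 else 0 with hg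
  have hgm : Measurable g := measurable_sineCorrelation_term ξ η
  have hgb : ∀ x, |g x| ≤ 1 := abs_sineCorrelation_term_le ξ η
  have hg0 : ∫ x in box 2 1, g x = 0 := by
    rw [hg, integral_sub _ (integrable_const _), integral_sin_phase_mul hξ]
    · simp
    · refine integrableOn_box_of_bounded (C := 1)
        ((measurable_phase _ _).sin.mul (measurable_phase _ _).sin) fun x => ?_
      rw [abs_mul]
      exact mul_le_one₀ (Real.abs_sin_le_one _) (abs_nonneg _) (Real.abs_sin_le_one _)
  have hsq := integral_sq_sum_of_iIndepFun (W := fun n ω => g (X n ω))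
    (fun n => hgm.comp (hX n)) (hind.comp (fun _ => g) fun _ => hgm)
    (fun n => Filter.Eventually.of_forall fun _ => hgb _)
    (fun n => by rw [integral_comp_uniform (hX n) (hXl n) hgm, hg0])
  have hle : ∫ ω, (∑ n, g (X n ω)) ^ 2 ∂P ≤ N := by
    rw [hsq]
    calc _ ≤ ∑ _n : Fin N, (1 : ℝ) := by
          refine Finset.sum_le_sum fun n _ => ?_
          calc _ ≤ ∫ _ω, (1 : ℝ) ∂P := by
                refine integral_mono_of_nonneg (Filter.Eventually.of_forall fun ω => sq_nonneg _)
                  (integrable_const _) (Filter.Eventually.of_forall fun ω => ?_)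
                exact (sq_le_one_iff_abs_le_one _).2 (hgb _)
            _ = 1 := by simp
      _ = N := by simp
  have hSb : ∀ ω, |∑ n, g (X n ω)| ≤ N := fun ω => by
    refine (Finset.abs_sum_le_sum_abs _ _).trans ?_
    refine (Finset.sum_le_sum fun n _ => hgb _).trans ?_
    simp
  have hI2 : Integrable (fun ω => (∑ n, g (X n ω)) ^ 2) P := by
    refine Integrable.of_bound ((Finset.measurable_sum _ fun n _ =>
      hgm.comp (hX n)).pow_const 2).aestronglyMeasurable (N ^ 2)
      (Filter.Eventually.of_forall fun ω => ?_)
    rw [norm_pow, Real.norm_eq_abs]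
    exact pow_le_pow_left₀ (abs_nonneg _) (hSb ω) 2
  have hr : 0 < √(N : ℝ) := Real.sqrt_pos.2 hN0
  have hr2 : √(N : ℝ) ^ 2 = N := Real.sq_sqrt hN0.le
  set r := √(N : ℝ)
  calc ∫ ω, |sineCorrelation (fun n => X n ω) ξ η| ∂P
      ≤ ∫ ω, ((∑ n, g (X n ω)) ^ 2 / (2 * r) + r / 2) ∂P := by
        refine integral_mono (integrable_sineCorrelation hX ξ η).abs
          ((hI2.div_const _).add (integrable_const _)) fun ω => ?_
        change |∑ n, g (X n ω)| ≤ _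
        set u := ∑ n, g (X n ω)
        have h1 : u ^ 2 / (2 * r) + r / 2 - |u| = (|u| - r) ^ 2 / (2 * r) := by
          rw [← sq_abs u]; field_simp; ring
        have h2 : 0 ≤ (|u| - r) ^ 2 / (2 * r) := by positivity
        linarith
    _ = (∫ ω, (∑ n, g (X n ω)) ^ 2 ∂P) / (2 * r) + r / 2 := by
        rw [integral_add (hI2.div_const _) (integrable_const _), integral_div]
        simp
    _ ≤ r ^ 2 / (2 * r) + r / 2 := by rw [hr2]; gcongr
    _ = r := by field_simp; norm_num

/-- The logarithm in dimension two: the weights of the pairs `ξ` with `ξ.2 ≤ ξ.1` dominate half of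
a harmonic sum. -/
lemma log_le_sum_freqWeight (M : ℕ) : Real.log (M + 1) / 2 ≤ ∑ ξ ∈ freqs M, freqWeight ξ := by
  have h1 : Real.log (M + 1) ≤ ∑ a ∈ Finset.Icc 1 M, (a : ℝ)⁻¹ := by
    have := log_add_one_le_harmonic M
    rw [harmonic_eq_sum_Icc] at this
    push_cast at this
    exact this
  calc Real.log (M + 1) / 2 ≤ (∑ a ∈ Finset.Icc 1 M, (a : ℝ)⁻¹) / 2 := by gcongr
    _ = ∑ a ∈ Finset.Icc 1 M, ∑ _b ∈ Finset.Icc 1 a, (2 * (a : ℝ) ^ 2)⁻¹ := by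
        rw [Finset.sum_div]
        refine Finset.sum_congr rfl fun a ha => ?_
        have : (a : ℝ) ≠ 0 := by
          have := (Finset.mem_Icc.1 ha).1
          exact_mod_cast (by omega : a ≠ 0)
        rw [Finset.sum_const, Nat.card_Icc, nsmul_eq_mul, Nat.add_sub_cancel]
        field_simp
    _ ≤ ∑ a ∈ Finset.Icc 1 M, ∑ b ∈ Finset.Icc 1 a, freqWeight (a, b) := by
        refine Finset.sum_le_sum fun a ha => Finset.sum_le_sum fun b hb => ?_
        rw [Finset.mem_Icc] at ha hb
        have h2 : (1 : ℝ) ≤ a := by exact_mod_cast ha.1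
        have h3 : (b : ℝ) ≤ a := by exact_mod_cast hb.2
        unfold freqWeight
        gcongr
        nlinarith [Nat.cast_nonneg (α := ℝ) b]
    _ ≤ ∑ a ∈ Finset.Icc 1 M, ∑ b ∈ Finset.Icc 1 M, freqWeight (a, b) := by
        refine Finset.sum_le_sum fun a ha => ?_
        refine Finset.sum_le_sum_of_subset_of_nonneg
          (Finset.Icc_subset_Icc_right (Finset.mem_Icc.1 ha).2) fun b _ _ => ?_
        unfold freqWeight; positivity
    _ = _ := by rw [freqs, Finset.sum_product]

lemma lower_bound_dim_two {N : ℕ} (hN : 1 ≤ N) {Ω : Type*} [MeasurableSpace Ω]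
    {P : Measure Ω} [IsProbabilityMeasure P] {X Y : Fin N → Ω → EuclideanSpace ℝ (Fin 2)}
    (hX : ∀ n, Measurable (X n)) (hY : ∀ n, Measurable (Y n))
    (hind : iIndepFun (Sum.elim X Y) P)
    (hXl : ∀ n, P.map (X n) = volume.restrict (box 2 1))
    (hYl : ∀ n, P.map (Y n) = volume.restrict (box 2 1)) :
    Real.log N / (10 ^ 7 * N) ≤ ∫ ω, matchingCost (fun n => X n ω) (fun n => Y n ω) ∂P := by
  have hN0 : (0 : ℝ) < N := by exact_mod_cast hN
  -- The cutoff `N ^ (1/8)` keeps the second derivatives of the test function and the correlations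
  -- between frequencies negligible, and costs only a constant factor in the logarithm.
  obtain ⟨M, hM1, hM8, hMlt⟩ : ∃ M : ℕ, 1 ≤ M ∧ M ^ 8 ≤ N ∧ N < (M + 1) ^ 8 := by
    refine ⟨Nat.findGreatest (fun m => m ^ 8 ≤ N) N, Nat.le_findGreatest hN (by simpa using hN),
      Nat.findGreatest_spec (P := fun m => m ^ 8 ≤ N) hN (by simpa using hN), ?_⟩
    by_contra! h
    have h1 : Nat.findGreatest (fun m => m ^ 8 ≤ N) N + 1 ≤ N :=
      (Nat.le_self_pow (by norm_num) _).trans h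
    have := Nat.le_findGreatest (P := fun m => m ^ 8 ≤ N) h1 h
    omega
  set r := √(N : ℝ) with hr
  have hr0 : 0 < r := Real.sqrt_pos.2 hN0
  have hr2 : r ^ 2 = N := Real.sq_sqrt hN0.le
  have hM1' : (1 : ℝ) ≤ M := by exact_mod_cast hM1
  have hM4 : (M : ℝ) ^ 4 ≤ r := by
    refine Real.le_sqrt_of_sq_le ?_
    rw [← pow_mul]
    exact_mod_cast hM8
  have hM2 : (M : ℝ) ^ 2 ≤ r := (pow_le_pow_right₀ hM1' (by norm_num)).trans hM4
  set Λ := ∑ ξ ∈ freqs M, freqWeight ξ with hΛ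
  have hΛ1 : 1 / 2 ≤ Λ := by
    have h11 : ((1, 1) : ℕ × ℕ) ∈ freqs M := by simp [freqs, hM1]
    refine le_trans (by norm_num [freqWeight]) (Finset.single_le_sum (f := freqWeight)
      (fun ξ _ => by unfold freqWeight; positivity) h11)
  have hΛlog : Real.log N ≤ 16 * Λ := by
    have h1 := log_le_sum_freqWeight M
    have h2 : Real.log N ≤ 8 * Real.log (M + 1) := by
      have := Real.log_le_log hN0 (by exact_mod_cast hMlt.le : (N : ℝ) ≤ ((M : ℝ) + 1) ^ 8)
      rw [Real.log_pow] at this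
      exact_mod_cast this
    linarith
  set E := ∫ ω, matchingCost (fun n => X n ω) (fun n => Y n ω) ∂P with hE
  have hIc := integrable_matchingCost hX hY hXl hYl
  have hE0 : 0 ≤ E := integral_nonneg fun ω => matchingCost_nonneg _ _
  have hne : ∀ ξ ∈ freqs M, ξ.1 ≠ 0 := fun ξ hξ => by
    simp only [freqs, Finset.mem_product, Finset.mem_Icc] at hξ
    omega
  set t := 1 / (6000 * r) with ht
  have ht0 : 0 < t := by positivity
  have hIS : ∀ ξ η, Integrable (fun ω => |sineCorrelation (fun n => X n ω) ξ η|) P :=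
    fun ξ η => (integrable_sineCorrelation hX ξ η).abs
  have hIB : Integrable (fun ω => ∑ ξ ∈ freqs M, ∑ η ∈ freqs M,
      |sineCorrelation (fun n => X n ω) ξ η|) P :=
    integrable_finsetSum _ fun ξ _ => integrable_finsetSum _ fun η _ => hIS ξ η
  have hB : ∫ ω, ∑ ξ ∈ freqs M, ∑ η ∈ freqs M, |sineCorrelation (fun n => X n ω) ξ η| ∂P ≤ N := by
    rw [integral_finsetSum _ fun ξ _ => integrable_finsetSum _ fun η _ => hIS ξ η]
    calc _ ≤ ∑ _ξ ∈ freqs M, ∑ _η ∈ freqs M, r := by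
          refine Finset.sum_le_sum fun ξ hξ => ?_
          rw [integral_finsetSum _ fun η _ => hIS ξ η]
          exact Finset.sum_le_sum fun η _ => integral_abs_sineCorrelation_le hN hX
            (hind.precomp (g := Sum.inl) Sum.inl_injective) hXl (hne ξ hξ) η
      _ = M ^ 4 * r := by
          simp only [Finset.sum_const, nsmul_eq_mul, freqs, Finset.card_product, Nat.card_Icc,
            Nat.add_sub_cancel]
          push_cast
          ring
      _ ≤ r * r := by gcongr
      _ = N := by rw [← sq, hr2]
  have hIW : ∀ ξ : ℕ × ℕ, Integrable (fun ω => freqWeight ξ *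
      |∑ n, Real.cos (phase ξ.1 ξ.2 (Y n ω)) - ∑ n, Real.cos (phase ξ.1 ξ.2 (X n ω))|) P :=
    fun ξ => by
      have hI : ∀ Z : Fin N → Ω → EuclideanSpace ℝ (Fin 2), (∀ n, Measurable (Z n)) →
          Integrable (fun ω => ∑ n, Real.cos (phase ξ.1 ξ.2 (Z n ω))) P := fun Z hZ =>
        integrable_finsetSum _ fun n _ => Integrable.of_bound
          ((measurable_phase _ _).comp (hZ n)).cos.aestronglyMeasurable 1
          (Filter.Eventually.of_forall fun _ => Real.abs_cos_le_one _)
      exact (((hI Y hY).sub (hI X hX)).abs).const_mul _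
  have hlow : r / 60 * Λ ≤ ∫ ω, ∑ ξ ∈ freqs M, freqWeight ξ *
      |∑ n, Real.cos (phase ξ.1 ξ.2 (Y n ω)) - ∑ n, Real.cos (phase ξ.1 ξ.2 (X n ω))| ∂P := by
    rw [integral_finsetSum _ fun ξ _ => hIW ξ, hΛ, Finset.mul_sum]
    refine Finset.sum_le_sum fun ξ hξ => ?_
    rw [integral_const_mul, mul_comm]
    exact mul_le_mul_of_nonneg_left (sqrt_le_integral_abs_wave hN hX hY hind hXl hYl (hne ξ hξ))
      (by unfold freqWeight; positivity)
  have hup : ∫ ω, ∑ ξ ∈ freqs M, freqWeight ξ *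
      |∑ n, Real.cos (phase ξ.1 ξ.2 (Y n ω)) - ∑ n, Real.cos (phase ξ.1 ξ.2 (X n ω))| ∂P ≤
      2 * Real.pi ^ 2 * t * (N / 2 * Λ + N) +
        (1 / (2 * t) + 12 * Real.pi ^ 2 * M ^ 2) * (N * E) := by
    have hI₁ : Integrable (fun ω => 2 * Real.pi ^ 2 * t * (N / 2 * Λ +
        ∑ ξ ∈ freqs M, ∑ η ∈ freqs M, |sineCorrelation (fun n => X n ω) ξ η|)) P :=
      ((integrable_const _).add hIB).const_mul _
    have hI₂ : Integrable (fun ω => (1 / (2 * t) + 12 * Real.pi ^ 2 * M ^ 2) *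
        (N * matchingCost (fun n => X n ω) (fun n => Y n ω))) P :=
      (hIc.const_mul _).const_mul _
    calc _ ≤ ∫ ω, (2 * Real.pi ^ 2 * t * (N / 2 * Λ +
          ∑ ξ ∈ freqs M, ∑ η ∈ freqs M, |sineCorrelation (fun n => X n ω) ξ η|) +
          (1 / (2 * t) + 12 * Real.pi ^ 2 * M ^ 2) *
            (N * matchingCost (fun n => X n ω) (fun n => Y n ω))) ∂P :=
          integral_mono (integrable_finsetSum _ fun ξ _ => hIW ξ)
            (hI₁.add hI₂) fun ω => sum_abs_wave_le hN _ _ ht0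
      _ = 2 * Real.pi ^ 2 * t * (N / 2 * Λ + ∫ ω, ∑ ξ ∈ freqs M, ∑ η ∈ freqs M,
            |sineCorrelation (fun n => X n ω) ξ η| ∂P) +
          (1 / (2 * t) + 12 * Real.pi ^ 2 * M ^ 2) * (N * E) := by
          rw [integral_add hI₁ hI₂, integral_const_mul, integral_const_mul,
            integral_const_mul, integral_add (integrable_const _) hIB, integral_const,
            probReal_univ, one_smul]
      _ ≤ _ := by gcongr
  have hpi : Real.pi ^ 2 ≤ 10 := by nlinarith [Real.pi_pos, Real.pi_lt_d2]
  have hfirst : 2 * Real.pi ^ 2 * t * (N / 2 * Λ + N) ≤ r / 120 * Λ := by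
    calc 2 * Real.pi ^ 2 * t * (N / 2 * Λ + N) ≤ 2 * 10 * t * (N / 2 * Λ + N * (2 * Λ)) := by
          gcongr
          nlinarith
      _ = r / 120 * Λ := by rw [ht, ← hr2]; field_simp; norm_num
  have hsecond : (1 / (2 * t) + 12 * Real.pi ^ 2 * M ^ 2) * (N * E) ≤ 3120 * r * (N * E) := by
    have h1 : 1 / (2 * t) = 3000 * r := by rw [ht]; field_simp; norm_num
    rw [h1]
    gcongr
    nlinarith [mul_le_mul hpi hM2 (by positivity) (by norm_num)]
  have hfinal : r * Λ ≤ r * (374400 * (N * E)) := by linarith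
  have hfinal' := le_of_mul_le_mul_left hfinal hr0
  rw [div_le_iff₀ (by positivity)]
  nlinarith [mul_nonneg hN0.le hE0]

/-! ### All dimensions -/

lemma exists_le_integral_matchingCost {d : ℕ} (hd : 0 < d) :
    ∃ C : ℝ, 0 < C ∧ ∀ N : ℕ, 1 ≤ N →
      ∀ (Ω : Type*) [MeasurableSpace Ω] (P : Measure Ω) [IsProbabilityMeasure P]
        (X Y : Fin N → Ω → EuclideanSpace ℝ (Fin d)),
        (∀ n, Measurable (X n)) → (∀ n, Measurable (Y n)) →
        iIndepFun (Sum.elim X Y) P →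
        (∀ n, P.map (X n) = volume.restrict (box d 1)) →
        (∀ n, P.map (Y n) = volume.restrict (box d 1)) →
        (microScale d 1 N * matchingRate d N) ^ 2 ≤
          C * ∫ ω, matchingCost (fun n => X n ω) (fun n => Y n ω) ∂P := by
  refine ⟨10 ^ 7, by norm_num, fun N hN Ω _ P _ X Y hX hY hind hXl hYl => ?_⟩
  have hN0 : (0 : ℝ) < N := by exact_mod_cast hN
  have hE0 : 0 ≤ ∫ ω, matchingCost (fun n => X n ω) (fun n => Y n ω) ∂P :=
    integral_nonneg fun ω => matchingCost_nonneg _ _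
  obtain ⟨-, -, hρ, -⟩ := microScale_one_bounds hd hN
  rw [mul_pow]
  rcases (by omega : d = 1 ∨ d = 2 ∨ 3 ≤ d) with rfl | rfl | hd3
  · have h := lower_bound_dim_one hN hX hY hind hXl hYl
    rw [pow_one] at hρ
    have e : microScale 1 1 N ^ 2 * matchingRate 1 N ^ 2 = 6 * (1 / (6 * N)) := by
      rw [matchingRate, if_pos rfl, Real.sq_sqrt hN0.le, hρ]
      field_simp
    rw [e]
    linarith
  · have h := lower_bound_dim_two hN hX hY hind hXl hYl
    have e : microScale 2 1 N ^ 2 * matchingRate 2 N ^ 2 =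
        10 ^ 7 * (Real.log N / (10 ^ 7 * N)) := by
      rw [matchingRate, if_neg (by norm_num), if_pos rfl,
        Real.sq_sqrt (Real.log_natCast_nonneg N), hρ]
      field_simp
    rw [e]
    linarith
  · have h := lower_bound_nearest_neighbour hd hN hX hY hind hXl hYl
    have e : matchingRate d N ^ 2 = 1 := by
      rw [matchingRate, if_neg (by omega), if_neg (by omega), one_pow]
    rw [e]
    linarith

theorem theorem1p1 (d : ℕ) (hd : 1 ≤ d) :
    ∃ C : ℝ, 0 < C ∧
      ∀ (L : ℝ) (N : ℕ), 0 < L → 1 ≤ N → (d = 2 → 2 ≤ N) →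
      ∀ (Ω : Type*) [MeasurableSpace Ω] (P : Measure Ω) [IsProbabilityMeasure P]
        (X Y : Fin N → Ω → EuclideanSpace ℝ (Fin d)),
        (∀ n, Measurable (X n)) → (∀ n, Measurable (Y n)) →
        iIndepFun (Sum.elim X Y) P →
        (∀ n, pdf.IsUniform (X n) (box d L) P volume) →
        (∀ n, pdf.IsUniform (Y n) (box d L) P volume) →
        Integrable (fun ω => matchingCost (fun n => X n ω) (fun n => Y n ω)) P ∧
        √(∫ ω, matchingCost (fun n => X n ω) (fun n => Y n ω) ∂P)
          ≤ C * (microScale d L N * matchingRate d N) ∧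
        microScale d L N * matchingRate d N
          ≤ C * √(∫ ω, matchingCost (fun n => X n ω) (fun n => Y n ω) ∂P) := by
  obtain ⟨C₁, hC₁, hup⟩ := exists_integral_matchingCost_le hd
  obtain ⟨C₂, hC₂, hlow⟩ := exists_le_integral_matchingCost hd
  refine ⟨max √C₁ √C₂, lt_max_of_lt_left (Real.sqrt_pos.2 hC₁), ?_⟩
  intro L N hL hN hN2 Ω _ P _ X Y hX hY hind hXu hYu
  set X' : Fin N → Ω → EuclideanSpace ℝ (Fin d) := fun n ω => L⁻¹ • X n ω with hX'
  set Y' : Fin N → Ω → EuclideanSpace ℝ (Fin d) := fun n ω => L⁻¹ • Y n ω with hY'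
  have hXm : ∀ n, Measurable (X' n) := fun n =>
    (measurable_const_smul L⁻¹).comp (hX n)
  have hYm : ∀ n, Measurable (Y' n) := fun n =>
    (measurable_const_smul L⁻¹).comp (hY n)
  have hXl : ∀ n, P.map (X' n) = volume.restrict (box d 1) := fun n =>
    map_inv_smul_of_isUniform hL (hX n) (hXu n)
  have hYl : ∀ n, P.map (Y' n) = volume.restrict (box d 1) := fun n =>
    map_inv_smul_of_isUniform hL (hY n) (hYu n)
  have hind' : iIndepFun (Sum.elim X' Y') P := by
    have := hind.comp (fun _ x => L⁻¹ • x) fun _ => measurable_const_smul L⁻¹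
    convert this using 1
    ext (i | i) <;> rfl
  have hcost : ∀ ω, matchingCost (fun n => X n ω) (fun n => Y n ω) =
      L ^ 2 * matchingCost (fun n => X' n ω) (fun n => Y' n ω) := fun ω => by
    rw [← matchingCost_smul]
    simp only [hX', hY', smul_inv_smul₀ hL.ne']
  simp only [hcost, integral_const_mul]
  have hmic : microScale d L N = L * microScale d 1 N := by
    simp only [microScale, one_mul]
  have hβ : 0 ≤ matchingRate d N := by
    unfold matchingRate
    split_ifs <;> positivity
  have hρ : 0 ≤ microScale d 1 N := by
    unfold microScale; positivity
  have h1 := hup N hN hN2 Ω P X' Y' hXm hYm hind' hXl hYl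
  have h2 := hlow N hN Ω P X' Y' hXm hYm hind' hXl hYl
  rw [Real.sqrt_mul (sq_nonneg L), Real.sqrt_sq hL.le, hmic, mul_assoc]
  refine ⟨(integrable_matchingCost hXm hYm hXl hYl).const_mul _, ?_, ?_⟩
  · rw [mul_left_comm (max _ _)]
    refine mul_le_mul_of_nonneg_left ?_ hL.le
    have h3 := Real.sqrt_le_sqrt h1
    rw [Real.sqrt_mul hC₁.le, Real.sqrt_sq (mul_nonneg hρ hβ)] at h3
    exact h3.trans (mul_le_mul_of_nonneg_right (le_max_left _ _) (mul_nonneg hρ hβ))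
  · rw [mul_left_comm (max _ _)]
    refine mul_le_mul_of_nonneg_left ?_ hL.le
    have h3 := Real.sqrt_le_sqrt h2
    rw [Real.sqrt_mul hC₂.le, Real.sqrt_sq (mul_nonneg hρ hβ)] at h3
    exact h3.trans (mul_le_mul_of_nonneg_right (le_max_right _ _) (Real.sqrt_nonneg _))
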